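/- Let $\mathcal L(\mathbb Z^2)$ be the square lattice: the graph with vertex set $\mathbb Z^2$ in which two points are adjacent when they are at Euclidean distance $1$. A simple closed loop $\alpha$ in $\mathcal L(\mathbb Z^2)$ is a cyclic sequence of more than two distinct vertices, each adjacent to the next (and the last adjacent to the first); its interior is the union of the bounded components of the complement in $\mathbb R^2$ of the closed polygonal curve it traces. A finite connected subgraph $G$ of $\mathcal L(\mathbb Z^2)$ is a simple grid graph, bounded by $\alpha$, if it consists of all of the vertices and edges of $\mathcal L(\mathbb Z^2)$ that are on or interior to $\alpha$. In this case $\partial G$ denotes the set of vertices of $\alpha$, and $\mathrm{Area}(G)$ the number of unit-square faces of $\mathcal L(\mathbb Z^2)$ in the interior of $\alpha$. The top-left boundary $\hat\partial G$ is the set of those $v\in V(G)$ for which the $1$-by-$1$ square (its four vertices and four edges) with bottom-right corner $v$ is not a subgraph of $G$. For a finite graph $H$, let $\tau(H)$ be the number of ways to choose one spanning tree from each connected component of $H$ (so $\tau(H)=1$ for the empty graph). Order $V(G)$ by rows from top to bottom, and within each row from left to right. For $v\in V(G)$ let $H'_v$ (respectively $H_v$) be the subgraph of $G$ induced by all vertices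 prior to $v$ (respectively prior to and including $v$), and let $m_v=\tau(H_v)/\tau(H'_v)$. If $G$ is a simple grid graph bounded by $\alpha$, then $m_v\le 4$ for every $v\in V(G)$ with $v\notin\hat\partial G$, and $m_v=1$ for every $v\in\hat\partial G$. Moreover $$\tau(G)\le 4^m,\qquad\text{where } m=\mathrm{Area}(G)=|V(G)|-\tfrac12|\partial G|-1=|V(G)|-|\hat\partial G|.$$ -/

import Mathlib

namespace GridGraph

/-- The square lattice `ℒ(ℤ²)`: vertex set `ℤ²`, with rook-adjacent points joined by an edge. -/
def squareLattice : SimpleGraph (ℤ × ℤ) where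
  Adj p q := (p.1 = q.1 ∧ |p.2 - q.2| = 1) ∨ (p.2 = q.2 ∧ |p.1 - q.1| = 1)
  symm := by
    refine ⟨fun p q h => ?_⟩
    rcases h with ⟨h1, h2⟩ | ⟨h1, h2⟩
    · exact Or.inl ⟨h1.symm, by rwa [abs_sub_comm]⟩
    · exact Or.inr ⟨h1.symm, by rwa [abs_sub_comm]⟩
  loopless := ⟨fun p h => by simp at h⟩

/-- A grid graph is a finite connected subgraph of the square lattice. -/
def IsGridGraph (G : squareLattice.Subgraph) : Prop :=
  G.verts.Finite ∧ G.Connected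

/-- A lattice point viewed as a point of the plane. -/
def toPlane (p : ℤ × ℤ) : ℝ × ℝ := ((p.1 : ℝ), (p.2 : ℝ))

/-- A simple closed loop in the square lattice: a cyclic sequence of more than two distinct
vertices, each one adjacent to the next (the last one being adjacent to the first). -/
structure SimpleClosedLoop where
  length : ℕ
  two_lt_length : 2 < length
  vertex : ZMod length → ℤ × ℤ
  injective : Function.Injective vertex
  adj : ∀ i, squareLattice.Adj (vertex i) (vertex (i + 1))

namespace SimpleClosedLoop

/-- The vertices of the loop. -/
def vertices (α : SimpleClosedLoop) : Set (ℤ × ℤ) := Set.range α.vertex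

/-- The closed polygonal curve in `ℝ²` traced by the loop. -/
def trace (α : SimpleClosedLoop) : Set (ℝ × ℝ) :=
  ⋃ i, segment ℝ (toPlane (α.vertex i)) (toPlane (α.vertex (i + 1)))

/-- The interior of the loop: the points of `ℝ²` off the curve whose connected component in the
complement of the curve is bounded. -/
def interior (α : SimpleClosedLoop) : Set (ℝ × ℝ) :=
  {x | x ∈ α.traceᶜ ∧ Bornology.IsBounded (connectedComponentIn α.traceᶜ x)}

/-- The subgraph of the square lattice comprised of all of the vertices and edges that are on and
interior to the loop. -/
def subgraph (α : SimpleClosedLoop) : squareLattice.Subgraph where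
  verts := {p | toPlane p ∈ α.trace ∪ α.interior}
  Adj p q := squareLattice.Adj p q ∧ segment ℝ (toPlane p) (toPlane q) ⊆ α.trace ∪ α.interior
  adj_sub h := h.1
  edge_vert h := h.2 (left_mem_segment ℝ _ _)
  symm := ⟨fun p q h => ⟨h.1.symm, by rw [segment_symm]; exact h.2⟩⟩

/-- The area enclosed by the loop: the number of faces (open unit squares) of the square lattice
that lie in the interior of the loop. -/
noncomputable def area (α : SimpleClosedLoop) : ℕ :=
  Set.ncard {p : ℤ × ℤ |
    Set.Ioo (p.1 : ℝ) (p.1 + 1) ×ˢ Set.Ioo (p.2 : ℝ) (p.2 + 1) ⊆ α.interior}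

end SimpleClosedLoop

/-- The vertices and edges of the `1`-by-`1` square whose bottom-right corner is `v`. -/
def box (v : ℤ × ℤ) : squareLattice.Subgraph :=
  (⊤ : squareLattice.Subgraph).induce
    {v, (v.1, v.2 + 1), (v.1 - 1, v.2 + 1), (v.1 - 1, v.2)}

/-- The top-left boundary of `G`: the vertices `v` of `G` such that the unit square whose
bottom-right corner is `v` is not a subgraph of `G`. -/
def topLeftBoundary (G : squareLattice.Subgraph) : Set (ℤ × ℤ) :=
  {v ∈ G.verts | ¬ box v ≤ G}

/-- `𝒯(H)`: the ways to choose one spanning tree from each connected component of `H`. Such a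
choice is encoded by the graph `T` on the vertices of `H` that is the union of the chosen trees. -/
def spanningForests {V : Type*} (H : SimpleGraph V) : Set (SimpleGraph V) :=
  {T | T ≤ H ∧ ∀ C : H.ConnectedComponent, (T.induce C.supp).IsTree}

/-- `τ(H)`, the number of elements of `𝒯(H)`. When `H` is connected this is its number of spanning
trees. -/
noncomputable def tau {V : Type*} (H : SimpleGraph V) : ℕ := (spanningForests H).ncard

/-- `p` strictly precedes `q` in the words-on-a-page order: rows from top to bottom, and each row
from left to right. -/
def Precedes (p q : ℤ × ℤ) : Prop := q.2 < p.2 ∨ (p.2 = q.2 ∧ p.1 < q.1)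

/-- `H'_v`: the subgraph of `G` induced by all vertices of `G` prior to `v`. -/
def priorGraph (G : squareLattice.Subgraph) (v : ℤ × ℤ) : squareLattice.Subgraph :=
  G.induce {w ∈ G.verts | Precedes w v}

/-- `H_v`: the subgraph of `G` induced by all vertices of `G` prior to and including `v`. -/
def uptoGraph (G : squareLattice.Subgraph) (v : ℤ × ℤ) : squareLattice.Subgraph :=
  G.induce {w ∈ G.verts | Precedes w v ∨ w = v}

/-- The multiplier `m_v = τ(H_v) / τ(H'_v)` of a vertex `v` of `G`. If `v` is the first vertex of
`G`, then both counts are `1` (the empty graph has exactly one, empty, choice), so that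
`m_v = 1`. -/
noncomputable def multiplier (G : squareLattice.Subgraph) (v : ℤ × ℤ) : ℝ :=
  (tau (uptoGraph G v).coe : ℝ) / (tau (priorGraph G v).coe : ℝ)

end GridGraph

/-! Build `G` one vertex at a time in page order. A new vertex `v` has at most two prior neighbours,
to its left and above. Its first new edge is pendant and leaves the number of spanning forests
unchanged. If the unit square with bottom-right corner `v` lies in `G`, the second edge closes a
path of length 3, and an edge exchange bounds the growth by 3 + 1 = 4 (`forestCount_sup_edge_le`).
Otherwise the second edge, if present, joins two components and again changes nothing
(`forestCount_sup_edge_of_not_reachable`): if the two neighbours were already joined through prior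
vertices, the resulting closed walk would wind oddly around that square and force it into the
interior (`mem_interiorFaces_of_crossing`).

So the exponent counts the vertices off the top-left boundary, which are the bottom-right corners of
interior faces. For the Pick-type formula, deleting the bottom edge of every interior face leaves a
spanning tree (`isTree_induce_combGraph`), and every loop edge borders exactly one interior face
(`sideSum_eq_one`). Together these relate vertices, faces and loop length. The plane topology is
reduced to one fact: a finite set of faces that can be left only across loop edges is interior
(`subset_interiorFaces_of_finite`). -/

namespace GridGraph

/-! ### Spanning forests and the effect of adding an edge. -/

section SpanningForest

variable {V : Type*}

theorem reachable_of_forall_adj {H T : SimpleGraph V} (h : ∀ a b, H.Adj a b → T.Reachable a b)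
    {a b : V} (hab : H.Reachable a b) : T.Reachable a b := by
  obtain ⟨p⟩ := hab
  induction p with
  | nil => exact .refl _
  | cons hadj p ih => exact (h _ _ hadj).trans ih

/-- A cycle all of whose vertices lie in a set is a cycle of the induced graph. -/
theorem isCycle_induce {G : SimpleGraph V} {s : Set V} {v : V} {c : G.Walk v v} (hc : c.IsCycle)
    (hs : ∀ x ∈ c.support, x ∈ s) : (c.induce s hs).IsCycle := by
  have h := c.map_induce hs
  rw [← SimpleGraph.Walk.isCycle_map_iff_of_injective
    (f := (SimpleGraph.Embedding.induce s).toHom) Subtype.val_injective]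
  rwa [h]

/-- The spanning forests of a graph: the maximal acyclic spanning subgraphs. -/
def maximalForests (H : SimpleGraph V) : Set (SimpleGraph V) :=
  {T | T ≤ H ∧ T.IsAcyclic ∧ ∀ a b, H.Adj a b → T.Reachable a b}

/-- A walk in `T ≤ H` never leaves its component of `H`, so the conditions component by component
amount to global ones. The global form is easier to follow when edges are added. -/
theorem spanningForests_eq_maximalForests (H : SimpleGraph V) :
    spanningForests H = maximalForests H := by
  ext T
  constructor
  · rintro ⟨hle, hT⟩
    refine ⟨hle, fun v c hc => ?_, fun a b hab => ?_⟩
    · classical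
      refine (hT (H.connectedComponentMk v)).isAcyclic (c.induce _ fun x hx => ?_)
        (isCycle_induce hc _)
      rw [SimpleGraph.ConnectedComponent.mem_supp_iff, SimpleGraph.ConnectedComponent.eq]
      exact ((c.takeUntil x hx).reachable.mono hle).symm
    · have ha : a ∈ (H.connectedComponentMk a).supp := rfl
      have hb : b ∈ (H.connectedComponentMk a).supp := by
        rw [SimpleGraph.ConnectedComponent.mem_supp_iff, SimpleGraph.ConnectedComponent.eq]
        exact hab.reachable.symm
      exact ((hT (H.connectedComponentMk a)).connected ⟨a, ha⟩ ⟨b, hb⟩).map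
        (SimpleGraph.Embedding.induce _).toHom
  · classical
    rintro ⟨hle, hac, hr⟩
    refine ⟨hle, fun C => ⟨?_, hac.induce _⟩⟩
    have : Nonempty C.supp := C.nonempty_supp.to_subtype
    refine SimpleGraph.Connected.mk ?_
    rintro ⟨a, ha⟩ ⟨b, hb⟩
    have hab : H.Reachable a b := by
      rw [← SimpleGraph.ConnectedComponent.eq]
      exact ha.trans hb.symm
    obtain ⟨p⟩ := reachable_of_forall_adj hr hab
    refine ⟨p.induce _ fun x hx => ?_⟩
    refine Eq.trans ?_ ha
    rw [SimpleGraph.ConnectedComponent.eq]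
    exact ((p.takeUntil x hx).reachable.mono hle).symm

theorem mem_of_mem_support_of_spanningCoe {s : Set V} {K : SimpleGraph s} {T : SimpleGraph V}
    (hT : T ≤ K.spanningCoe) {a b : V} (p : T.Walk a b) (ha : a ∈ s) : ∀ x ∈ p.support, x ∈ s := by
  induction p with
  | nil => simpa using ha
  | cons h p ih =>
    intro x hx
    rw [SimpleGraph.Walk.support_cons, List.mem_cons] at hx
    rcases hx with rfl | hx
    · exact ha
    · refine ih ?_ x hx
      have := hT h
      simp only [SimpleGraph.map_adj] at this
      obtain ⟨u, w, _, _, rfl⟩ := this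
      exact w.2

theorem isAcyclic_spanningCoe {s : Set V} {T : SimpleGraph s} (hT : T.IsAcyclic) :
    T.spanningCoe.IsAcyclic := by
  intro v c hc
  have hv : v ∈ s := by
    have := c.adj_snd hc.not_nil
    simp only [SimpleGraph.map_adj] at this
    obtain ⟨u, w, _, rfl, _⟩ := this
    exact u.2
  have h1 := isCycle_induce hc (mem_of_mem_support_of_spanningCoe le_rfl c hv)
  have h2 : (T.spanningCoe.induce s).IsAcyclic := by
    rw [SimpleGraph.induce_spanningCoe]; exact hT
  exact h2 _ h1

theorem maximalForests_spanningCoe {s : Set V} (K : SimpleGraph s) :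
    maximalForests K.spanningCoe = SimpleGraph.spanningCoe '' maximalForests K := by
  ext T
  constructor
  · rintro ⟨hle, hac, hr⟩
    have hsub : T.support ⊆ s := by
      rintro a ⟨b, hab⟩
      have := hle hab
      simp only [SimpleGraph.map_adj] at this
      obtain ⟨u, w, _, rfl, _⟩ := this
      exact u.2
    refine ⟨T.induce s, ⟨?_, hac.induce _, ?_⟩, (SimpleGraph.spanningCoe_induce_eq_self T s).2 hsub⟩
    · intro a b hab
      have := hle hab
      simp only [SimpleGraph.map_adj] at this
      obtain ⟨u, w, h, h1, h2⟩ := this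
      rwa [← Subtype.ext h1, ← Subtype.ext h2]
    · intro a b hab
      obtain ⟨p⟩ := hr a b (by simpa using hab)
      exact ⟨p.induce s (mem_of_mem_support_of_spanningCoe hle p a.2)⟩
  · rintro ⟨T, ⟨hle, hac, hr⟩, rfl⟩
    refine ⟨SimpleGraph.map_monotone _ hle, isAcyclic_spanningCoe hac, fun a b hab => ?_⟩
    simp only [SimpleGraph.map_adj] at hab
    obtain ⟨u, w, h, rfl, rfl⟩ := hab
    exact (hr _ _ h).map (SimpleGraph.Embedding.map _ T).toHom

/-- The number of spanning forests of a graph. -/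
noncomputable def forestCount (H : SimpleGraph V) : ℕ := (maximalForests H).ncard

/-- Vertices outside `G'` become isolated and carry no choice. All counts now live on one vertex
type, so passing from `H'_v` to `H_v` only adds edges. -/
theorem tau_coe {G : SimpleGraph V} (G' : G.Subgraph) :
    tau G'.coe = forestCount G'.spanningCoe := by
  rw [tau, forestCount, spanningForests_eq_maximalForests, ← SimpleGraph.Subgraph.spanningCoe_coe,
    maximalForests_spanningCoe,
    Set.ncard_image_of_injective]
  exact SimpleGraph.map_injective _

theorem finite_maximalForests {H : SimpleGraph V} (hH : H.edgeSet.Finite) :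
    (maximalForests H).Finite := by
  refine Set.Finite.of_finite_image (f := SimpleGraph.edgeSet) (hH.finite_subsets.subset ?_)
    SimpleGraph.edgeSet_injective.injOn
  rintro _ ⟨T, hT, rfl⟩
  exact SimpleGraph.edgeSet_mono hT.1

theorem maximalForests_nonempty (H : SimpleGraph V) : (maximalForests H).Nonempty := by
  obtain ⟨F, hle, hac, hr⟩ := SimpleGraph.exists_isAcyclic_reachable_eq_le (G := H)
  exact ⟨F, hle, hac, fun a b h => hr ▸ h.reachable⟩

theorem forestCount_pos {H : SimpleGraph V} (hH : H.edgeSet.Finite) : 0 < forestCount H :=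
  (Set.ncard_pos (finite_maximalForests hH)).2 (maximalForests_nonempty H)

theorem forestCount_bot : forestCount (⊥ : SimpleGraph V) = 1 := by
  rw [forestCount, Set.ncard_eq_one]
  refine ⟨⊥, Set.Subset.antisymm (fun T hT => le_bot_iff.1 hT.1) ?_⟩
  rintro _ rfl
  exact ⟨le_rfl, SimpleGraph.isAcyclic_bot, fun a b h => h.elim⟩

/-- Reachability after adding an edge. -/
theorem reachable_of_sup_edge {S : SimpleGraph V} {x y a b : V}
    (h : (S ⊔ SimpleGraph.edge x y).Reachable a b) :
    S.Reachable a b ∨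
      (S.Reachable a x ∨ S.Reachable a y) ∧ (S.Reachable x b ∨ S.Reachable y b) := by
  obtain ⟨p⟩ := h
  induction p with
  | nil => exact .inl (.refl _)
  | cons hadj p ih =>
    rw [SimpleGraph.sup_adj, SimpleGraph.edge_adj] at hadj
    rcases hadj with hadj | ⟨⟨rfl, rfl⟩ | ⟨rfl, rfl⟩, -⟩
    · have := hadj.reachable
      rcases ih with h | ⟨h1, h2⟩
      · exact .inl (this.trans h)
      · exact .inr ⟨h1.imp this.trans this.trans, h2⟩
    · refine .inr ⟨.inl (.refl _), ?_⟩
      rcases ih with h | ⟨h1, h2⟩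
      · exact .inr h
      · exact h2
    · refine .inr ⟨.inr (.refl _), ?_⟩
      rcases ih with h | ⟨h1, h2⟩
      · exact .inl h
      · exact h2

/-- Adding an edge between two components does not change the number of spanning forests. -/
theorem forestCount_sup_edge_of_not_reachable {H : SimpleGraph V} {x y : V}
    (hxy : ¬ H.Reachable x y) : forestCount (H ⊔ SimpleGraph.edge x y) = forestCount H := by
  have hne : x ≠ y := by rintro rfl; exact hxy (.refl _)
  have hinf : ∀ T ≤ H, (T ⊔ SimpleGraph.edge x y) ⊓ H = T := by
    intro T hT
    ext a b
    simp only [SimpleGraph.inf_adj, SimpleGraph.sup_adj, SimpleGraph.edge_adj]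
    constructor
    · rintro ⟨h | ⟨⟨rfl, rfl⟩ | ⟨rfl, rfl⟩, -⟩, h'⟩
      · exact h
      · exact (hxy h'.reachable).elim
      · exact (hxy h'.reachable.symm).elim
    · exact fun h => ⟨.inl h, hT h⟩
  have himage : maximalForests (H ⊔ SimpleGraph.edge x y) =
      (· ⊔ SimpleGraph.edge x y) '' maximalForests H := by
    ext T
    constructor
    · rintro ⟨hle, hac, hr⟩
      -- Without the new edge, `T` would lie in `H` and still join `x` to `y`.
      have hT : T.Adj x y := by
        by_contra hT
        refine hxy ((hr x y (by simp [SimpleGraph.edge_adj, hne])).mono fun a b hab => ?_)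
        rcases hle hab with h | h
        · exact h
        · rw [SimpleGraph.edge_adj] at h
          rcases h with ⟨⟨rfl, rfl⟩ | ⟨rfl, rfl⟩, -⟩
          · exact (hT hab).elim
          · exact (hT hab.symm).elim
      have heq : T ⊓ H ⊔ SimpleGraph.edge x y = T := by
        rw [sup_inf_right, inf_eq_left.2]
        · exact sup_eq_left.2 ((SimpleGraph.edge_le_iff _).2 (.inr hT))
        · exact sup_le hle le_sup_right
      refine ⟨T ⊓ H, ⟨inf_le_right, hac.anti inf_le_left, fun a b hab => ?_⟩, heq⟩
      have h := hr a b (.inl hab)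
      rw [← heq] at h
      have up : ∀ {c d}, (T ⊓ H).Reachable c d → H.Reachable c d := fun h => h.mono inf_le_right
      rcases reachable_of_sup_edge h with h | ⟨h1 | h1, h2 | h2⟩
      · exact h
      · exact h1.trans h2
      · exact (hxy (((up h1).symm.trans hab.reachable).trans (up h2).symm)).elim
      · exact (hxy (((up h1).symm.trans hab.reachable).trans (up h2).symm).symm).elim
      · exact h1.trans h2
    · rintro ⟨T, ⟨hle, hac, hr⟩, rfl⟩
      refine ⟨sup_le_sup_right hle _,
        hac.sup_edge_of_not_reachable fun h => hxy (h.mono hle), fun a b hab => ?_⟩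
      rcases hab with h | h
      · exact (hr a b h).mono le_sup_left
      · exact SimpleGraph.Adj.reachable (.inr h)
  rw [forestCount, forestCount, himage, Set.InjOn.ncard_image]
  intro T hT T' hT' h
  rw [← hinf T hT.1, ← hinf T' hT'.1]
  exact congrArg (· ⊓ H) h

/-- Adding an edge whose endpoints are already joined by a walk of length `k` multiplies the number
of spanning forests by at most `k + 1`. -/
theorem forestCount_sup_edge_le {H : SimpleGraph V} (hH : H.edgeSet.Finite) {x y : V}
    (p : H.Walk x y) :
    forestCount (H ⊔ SimpleGraph.edge x y) ≤ (p.length + 1) * forestCount H := by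
  classical
  -- Edge exchange: a forest containing `xy` comes from a forest of `H` by trading some edge `e` of
  -- `p` for `xy`. The forests without `xy` give the extra 1 in the factor.
  let g : Sym2 V → SimpleGraph V → SimpleGraph V :=
    fun e T => T.deleteEdges {e} ⊔ SimpleGraph.edge x y
  have hcover : maximalForests (H ⊔ SimpleGraph.edge x y) ⊆
      maximalForests H ∪ ⋃ e ∈ p.edges.toFinset, g e '' maximalForests H := by
    rintro T ⟨hle, hac, hr⟩
    have hleH : ∀ {a b}, T.Adj a b → s(a, b) ≠ s(x, y) → H.Adj a b := by
      intro a b hab hne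
      rcases hle hab with h | h
      · exact h
      · rw [SimpleGraph.edge_adj] at h
        exact (hne (by rw [Sym2.eq_iff]; exact h.1)).elim
    by_cases hT : T.Adj x y
    · right
      set S := T.deleteEdges {s(x, y)} with hS
      have hST : S ≤ T := SimpleGraph.deleteEdges_le _
      have hSH : S ≤ H := by
        intro a b hab
        rw [hS, SimpleGraph.deleteEdges_adj] at hab
        exact hleH hab.1 hab.2
      have hTS : T = S ⊔ SimpleGraph.edge x y := by
        ext a b
        rw [SimpleGraph.sup_adj, hS, SimpleGraph.deleteEdges_adj, SimpleGraph.edge_adj,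
          Set.mem_singleton_iff]
        constructor
        · intro h
          by_cases he : s(a, b) = s(x, y)
          · exact .inr ⟨by simpa using he, h.ne⟩
          · exact .inl ⟨h, he⟩
        · rintro (h | ⟨⟨rfl, rfl⟩ | ⟨rfl, rfl⟩, -⟩)
          · exact h.1
          · exact hT
          · exact hT.symm
      have hbr : ¬ S.Reachable x y := SimpleGraph.isAcyclic_iff_forall_adj_isBridge.1 hac hT
      -- Removing `xy` from the forest separates `x` from `y`, so `p` leaves the piece containing
      -- `x` along some edge `ab`, which reconnects the two pieces.
      obtain ⟨d, hd, hd1, hd2⟩ := p.exists_boundary_dart {a | S.Reachable x a} (.refl _) hbr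
      obtain ⟨⟨a, b⟩, hab⟩ := d
      simp only [Set.mem_ofPred_eq] at hd1 hd2
      have hyb : S.Reachable y b := by
        have h : T.Reachable a b := hr a b (.inl hab)
        have h' : T.Reachable x b := (hd1.mono hST).trans h
        rw [hTS] at h'
        rcases reachable_of_sup_edge h' with h | ⟨-, h | h⟩
        · exact (hd2 h).elim
        · exact (hd2 h).elim
        · exact h
      have hnab : ¬ S.Reachable a b := fun h => hd2 (hd1.trans h)
      have hne : a ≠ b := by rintro rfl; exact hnab (.refl _)
      refine Set.mem_iUnion₂.2 ⟨s(a, b), ?_, S ⊔ SimpleGraph.edge a b, ⟨?_, ?_, ?_⟩, ?_⟩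
      · rw [List.mem_toFinset]
        exact List.mem_map.2 ⟨_, hd, rfl⟩
      · exact sup_le hSH ((SimpleGraph.edge_le_iff _).2 (.inr hab))
      · exact (hac.anti hST).sup_edge_of_not_reachable hnab
      · have hxy : (S ⊔ SimpleGraph.edge a b).Reachable x y := by
          refine (hd1.mono le_sup_left).trans (.trans (SimpleGraph.Adj.reachable ?_)
            (hyb.mono le_sup_left).symm)
          exact .inr (by simp [SimpleGraph.edge_adj, hne])
        intro c d hcd
        refine reachable_of_forall_adj (fun c d h => ?_) (hr c d (.inl hcd))
        rw [hTS] at h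
        rcases h with h | h
        · exact SimpleGraph.Adj.reachable (.inl h)
        · rw [SimpleGraph.edge_adj] at h
          rcases h with ⟨⟨rfl, rfl⟩ | ⟨rfl, rfl⟩, -⟩
          · exact hxy
          · exact hxy.symm
      · have : (S ⊔ SimpleGraph.edge a b).deleteEdges {s(a, b)} = S := by
          ext c d
          rw [SimpleGraph.deleteEdges_adj, SimpleGraph.sup_adj, SimpleGraph.edge_adj,
            Set.mem_singleton_iff]
          constructor
          · rintro ⟨h | h, h'⟩
            · exact h
            · exact (h' (by rw [Sym2.eq_iff]; exact h.1)).elim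
          · refine fun h => ⟨.inl h, fun h' => hnab ?_⟩
            rw [Sym2.eq_iff] at h'
            rcases h' with ⟨rfl, rfl⟩ | ⟨rfl, rfl⟩
            · exact h.reachable
            · exact h.reachable.symm
        change (S ⊔ SimpleGraph.edge a b).deleteEdges {s(a, b)} ⊔ SimpleGraph.edge x y = T
        rw [this, hTS]
    · left
      refine ⟨fun a b hab => hleH hab fun h => hT ?_, hac, fun a b hab => hr a b (.inl hab)⟩
      rw [Sym2.eq_iff] at h
      rcases h with ⟨rfl, rfl⟩ | ⟨rfl, rfl⟩
      · exact hab
      · exact hab.symm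
  have hfin := finite_maximalForests hH
  have hfin' : (⋃ e ∈ p.edges.toFinset, g e '' maximalForests H).Finite :=
    Set.Finite.biUnion (Finset.finite_toSet _) fun e _ => hfin.image _
  calc forestCount (H ⊔ SimpleGraph.edge x y)
      ≤ (maximalForests H ∪ ⋃ e ∈ p.edges.toFinset, g e '' maximalForests H).ncard :=
        Set.ncard_le_ncard hcover (hfin.union hfin')
    _ ≤ forestCount H + (⋃ e ∈ p.edges.toFinset, g e '' maximalForests H).ncard :=
        Set.ncard_union_le _ _
    _ ≤ forestCount H + ∑ e ∈ p.edges.toFinset, (g e '' maximalForests H).ncard := by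
        gcongr
        exact Finset.set_ncard_biUnion_le _ _
    _ ≤ forestCount H + ∑ e ∈ p.edges.toFinset, forestCount H := by
        gcongr
        exact Set.ncard_image_le hfin
    _ ≤ forestCount H + p.length * forestCount H := by
        rw [Finset.sum_const, smul_eq_mul]
        gcongr
        exact (List.toFinset_card_le _).trans p.length_edges.le
    _ = (p.length + 1) * forestCount H := by ring

end SpanningForest
-- Lattice faces and the interior of a loop.
section Plane

theorem adj_iff {p q : ℤ × ℤ} : squareLattice.Adj p q ↔
    q = (p.1, p.2 + 1) ∨ p = (q.1, q.2 + 1) ∨ q = (p.1 + 1, p.2) ∨ p = (q.1 + 1, q.2) := by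
  obtain ⟨a, b⟩ := p
  obtain ⟨c, d⟩ := q
  simp only [squareLattice, Prod.mk.injEq, abs_eq (zero_le_one' ℤ)]
  omega

theorem adj_up (a b : ℤ) : squareLattice.Adj (a, b) (a, b + 1) := adj_iff.2 (.inl rfl)

theorem adj_right (a b : ℤ) : squareLattice.Adj (a, b) (a + 1, b) :=
  adj_iff.2 (.inr (.inr (.inl rfl)))

/-- The open unit square whose bottom-left corner is `p`. -/
def cell (p : ℤ × ℤ) : Set (ℝ × ℝ) :=
  Set.Ioo (p.1 : ℝ) (p.1 + 1) ×ˢ Set.Ioo (p.2 : ℝ) (p.2 + 1)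

/-- The closed unit square whose bottom-left corner is `p`. -/
def closedCell (p : ℤ × ℤ) : Set (ℝ × ℝ) :=
  Set.Icc (p.1 : ℝ) (p.1 + 1) ×ˢ Set.Icc (p.2 : ℝ) (p.2 + 1)

theorem mem_closedCell {p : ℤ × ℤ} {x : ℝ × ℝ} : x ∈ closedCell p ↔
    ((p.1 : ℝ) ≤ x.1 ∧ x.1 ≤ p.1 + 1) ∧ (p.2 : ℝ) ≤ x.2 ∧ x.2 ≤ p.2 + 1 := Iff.rfl

theorem closure_cell (p : ℤ × ℤ) : closure (cell p) = closedCell p := by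
  rw [cell, closure_prod_eq, closure_Ioo (by simp), closure_Ioo (by simp), closedCell]

theorem isPreconnected_cell (p : ℤ × ℤ) : IsPreconnected (cell p) :=
  isPreconnected_Ioo.prod isPreconnected_Ioo

theorem segment_up (a b : ℤ) : segment ℝ (toPlane (a, b)) (toPlane (a, b + 1)) =
    {x : ℝ × ℝ | x.1 = a ∧ (b : ℝ) ≤ x.2 ∧ x.2 ≤ b + 1} := by
  have h : (b : ℝ) ≤ ((b + 1 : ℤ) : ℝ) := by push_cast; linarith
  rw [toPlane, toPlane, ← Prod.image_mk_segment_right, segment_eq_Icc h]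
  push_cast
  ext ⟨s, t⟩
  constructor
  · rintro ⟨u, hu, he⟩
    obtain ⟨rfl, rfl⟩ := Prod.mk.inj he
    exact ⟨rfl, hu⟩
  · rintro ⟨h, hu⟩
    exact ⟨t, hu, Prod.ext h.symm rfl⟩

theorem segment_right (a b : ℤ) : segment ℝ (toPlane (a, b)) (toPlane (a + 1, b)) =
    {x : ℝ × ℝ | x.2 = b ∧ (a : ℝ) ≤ x.1 ∧ x.1 ≤ a + 1} := by
  have h : (a : ℝ) ≤ ((a + 1 : ℤ) : ℝ) := by push_cast; linarith
  rw [toPlane, toPlane, ← Prod.image_mk_segment_left, segment_eq_Icc h]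
  push_cast
  ext ⟨s, t⟩
  constructor
  · rintro ⟨u, hu, he⟩
    obtain ⟨rfl, rfl⟩ := Prod.mk.inj he
    exact ⟨rfl, hu⟩
  · rintro ⟨h, hu⟩
    exact ⟨s, hu, Prod.ext rfl h.symm⟩

namespace SimpleClosedLoop

variable (α : SimpleClosedLoop)

instance : NeZero α.length := ⟨by have := α.two_lt_length; omega⟩

/-- The graph on the lattice points formed by the edges of the loop. -/
def edgeGraph : SimpleGraph (ℤ × ℤ) where
  Adj p q := ∃ i, (α.vertex i = p ∧ α.vertex (i + 1) = q) ∨ (α.vertex i = q ∧ α.vertex (i + 1) = p)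
  symm := ⟨fun _ _ ⟨i, h⟩ => ⟨i, h.symm⟩⟩
  loopless := ⟨fun p ⟨i, h⟩ => (α.adj i).ne (by rcases h with h | h <;> rw [h.1, h.2])⟩

/-- The faces interior to the loop, each represented by its bottom-left corner. -/
def interiorFaces : Set (ℤ × ℤ) := {p | cell p ⊆ α.interior}

variable {α}

theorem edgeGraph_adj_vertex (i : ZMod α.length) :
    α.edgeGraph.Adj (α.vertex i) (α.vertex (i + 1)) := ⟨i, .inl ⟨rfl, rfl⟩⟩

theorem edgeGraph_le : α.edgeGraph ≤ squareLattice := by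
  rintro p q ⟨i, ⟨rfl, rfl⟩ | ⟨rfl, rfl⟩⟩
  · exact α.adj i
  · exact (α.adj i).symm

theorem segment_subset_trace {p q : ℤ × ℤ} (h : α.edgeGraph.Adj p q) :
    segment ℝ (toPlane p) (toPlane q) ⊆ α.trace := by
  obtain ⟨i, ⟨rfl, rfl⟩ | ⟨rfl, rfl⟩⟩ := h
  · exact Set.subset_iUnion_of_subset i le_rfl
  · rw [segment_symm]
    exact Set.subset_iUnion_of_subset i le_rfl

theorem mem_trace_iff {x : ℝ × ℝ} : x ∈ α.trace ↔
    (∃ a b : ℤ, α.edgeGraph.Adj (a, b) (a, b + 1) ∧ x.1 = a ∧ (b : ℝ) ≤ x.2 ∧ x.2 ≤ b + 1) ∨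
    (∃ a b : ℤ, α.edgeGraph.Adj (a, b) (a + 1, b) ∧ x.2 = b ∧ (a : ℝ) ≤ x.1 ∧ x.1 ≤ a + 1) := by
  constructor
  · intro hx
    obtain ⟨i, hi⟩ := Set.mem_iUnion.1 hx
    have h1 := α.edgeGraph_adj_vertex i
    generalize α.vertex i = p at *
    generalize α.vertex (i + 1) = q at *
    obtain ⟨a, b⟩ := p
    obtain ⟨c, d⟩ := q
    rcases adj_iff.1 (edgeGraph_le h1) with h | h | h | h <;>
      obtain ⟨rfl, rfl⟩ := Prod.mk.inj h
    · rw [segment_up] at hi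
      exact .inl ⟨_, _, h1, hi⟩
    · rw [segment_symm, segment_up] at hi
      exact .inl ⟨_, _, h1.symm, hi⟩
    · rw [segment_right] at hi
      exact .inr ⟨_, _, h1, hi⟩
    · rw [segment_symm, segment_right] at hi
      exact .inr ⟨_, _, h1.symm, hi⟩
  · rintro (⟨a, b, h, hx⟩ | ⟨a, b, h, hx⟩)
    · exact segment_subset_trace h (by rw [segment_up]; exact hx)
    · exact segment_subset_trace h (by rw [segment_right]; exact hx)

theorem isClosed_trace : IsClosed α.trace := by
  refine isClosed_iUnion_of_finite fun i => ?_
  rw [← convexHull_pair]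
  exact (Set.toFinite _).isClosed_convexHull (𝕜 := ℝ)

theorem disjoint_cell_trace (p : ℤ × ℤ) : cell p ⊆ α.traceᶜ := by
  rintro x ⟨⟨h1, h2⟩, h3, h4⟩ hx
  rcases mem_trace_iff.1 hx with ⟨a, b, -, h, -⟩ | ⟨a, b, -, h, -⟩
  · rw [h] at h1 h2
    norm_cast at h1 h2
    omega
  · rw [h] at h3 h4
    norm_cast at h3 h4
    omega

/-- The midpoint of a lattice edge lies on no other lattice edge, so this one point decides whether
the edge belongs to the loop. -/
theorem adj_up_of_mem_trace {a b : ℤ} (h : ((a : ℝ), (b : ℝ) + 1 / 2) ∈ α.trace) :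
    α.edgeGraph.Adj (a, b) (a, b + 1) := by
  rcases mem_trace_iff.1 h with ⟨c, d, h, h1, h2, h3⟩ | ⟨c, d, -, h1, -⟩
  · dsimp only at h1 h2 h3
    have e1 : c = a := by exact_mod_cast h1.symm
    have e2 : d < b + 1 := by
      have : (d : ℝ) < ((b + 1 : ℤ) : ℝ) := by push_cast; linarith
      exact_mod_cast this
    have e3 : b < d + 1 := by
      have : (b : ℝ) < ((d + 1 : ℤ) : ℝ) := by push_cast; linarith
      exact_mod_cast this
    obtain rfl : d = b := by omega
    rwa [← e1]
  · dsimp only at h1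
    have : ((2 * b + 1 : ℤ) : ℝ) = ((2 * d : ℤ) : ℝ) := by push_cast; linarith
    have := Int.cast_injective this
    omega

theorem adj_right_of_mem_trace {a b : ℤ} (h : ((a : ℝ) + 1 / 2, (b : ℝ)) ∈ α.trace) :
    α.edgeGraph.Adj (a, b) (a + 1, b) := by
  rcases mem_trace_iff.1 h with ⟨c, d, -, h1, -⟩ | ⟨c, d, h, h1, h2, h3⟩
  · dsimp only at h1
    have : ((2 * a + 1 : ℤ) : ℝ) = ((2 * c : ℤ) : ℝ) := by push_cast; linarith
    have := Int.cast_injective this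
    omega
  · dsimp only at h1 h2 h3
    have e1 : d = b := by exact_mod_cast h1.symm
    have e2 : c < a + 1 := by
      have : (c : ℝ) < ((a + 1 : ℤ) : ℝ) := by push_cast; linarith
      exact_mod_cast this
    have e3 : a < c + 1 := by
      have : (a : ℝ) < ((c + 1 : ℤ) : ℝ) := by push_cast; linarith
      exact_mod_cast this
    obtain rfl : c = a := by omega
    rwa [← e1]

/-- A point off the loop lies in the interior if and only if a face whose closure contains it
does. -/
theorem mem_interior_iff_of_mem_closedCell {x : ℝ × ℝ} {f : ℤ × ℤ} (hx : x ∉ α.trace)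
    (hf : x ∈ closedCell f) : x ∈ α.interior ↔ f ∈ α.interiorFaces := by
  -- A small ball about `x` meets the open face, and their union is connected and misses the loop.
  obtain ⟨ε, hε, hball⟩ := Metric.isOpen_iff.1 (isClosed_trace (α := α)).isOpen_compl x hx
  obtain ⟨y, hyb, hyc⟩ : (Metric.ball x ε ∩ cell f).Nonempty := by
    rw [← closure_cell] at hf
    exact mem_closure_iff.1 hf _ Metric.isOpen_ball (Metric.mem_ball_self hε)
  have hU : IsPreconnected (Metric.ball x ε ∪ cell f) :=
    IsPreconnected.union y hyb hyc (convex_ball x ε).isPreconnected (isPreconnected_cell f)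
  have hsub := hU.subset_connectedComponentIn (.inl (Metric.mem_ball_self hε))
    (Set.union_subset hball (disjoint_cell_trace f))
  have heq : ∀ z ∈ cell f, connectedComponentIn α.traceᶜ z = connectedComponentIn α.traceᶜ x :=
    fun z hz => (connectedComponentIn_eq (hsub (.inr hz))).symm
  constructor
  · intro h z hz
    exact ⟨disjoint_cell_trace f hz, by rw [heq z hz]; exact h.2⟩
  · intro h
    exact ⟨hx, by rw [← heq y hyc]; exact (h hyc).2⟩

theorem closedCell_subset {f : ℤ × ℤ} (hf : f ∈ α.interiorFaces) :
    closedCell f ⊆ α.trace ∪ α.interior := by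
  intro x hx
  by_cases h : x ∈ α.trace
  · exact .inl h
  · exact .inr ((mem_interior_iff_of_mem_closedCell h hx).2 hf)

theorem subgraph_adj_of_edgeGraph_adj {p q : ℤ × ℤ} (h : α.edgeGraph.Adj p q) :
    α.subgraph.Adj p q :=
  ⟨edgeGraph_le h, (segment_subset_trace h).trans Set.subset_union_left⟩

section

variable {a b : ℤ}

theorem mid_up_mem_right (a b : ℤ) : ((a : ℝ), (b : ℝ) + 1 / 2) ∈ closedCell (a, b) := by
  rw [mem_closedCell]; dsimp only; refine ⟨⟨?_, ?_⟩, ?_, ?_⟩ <;> linarith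

theorem mid_up_mem_left (a b : ℤ) : ((a : ℝ), (b : ℝ) + 1 / 2) ∈ closedCell (a - 1, b) := by
  rw [mem_closedCell]; dsimp only; push_cast; refine ⟨⟨?_, ?_⟩, ?_, ?_⟩ <;> linarith

theorem mid_right_mem_above (a b : ℤ) : ((a : ℝ) + 1 / 2, (b : ℝ)) ∈ closedCell (a, b) := by
  rw [mem_closedCell]; dsimp only; refine ⟨⟨?_, ?_⟩, ?_, ?_⟩ <;> linarith

theorem mid_right_mem_below (a b : ℤ) : ((a : ℝ) + 1 / 2, (b : ℝ)) ∈ closedCell (a, b - 1) := by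
  rw [mem_closedCell]; dsimp only; push_cast; refine ⟨⟨?_, ?_⟩, ?_, ?_⟩ <;> linarith

/-- Both faces have the midpoint of their common edge in their closure, and that midpoint is off the
loop. -/
theorem mem_faces_iff_left (h : ¬ α.edgeGraph.Adj (a, b) (a, b + 1)) :
    (a, b) ∈ α.interiorFaces ↔ (a - 1, b) ∈ α.interiorFaces := by
  have h := mt adj_up_of_mem_trace h
  rw [← mem_interior_iff_of_mem_closedCell h (mid_up_mem_right a b),
    ← mem_interior_iff_of_mem_closedCell h (mid_up_mem_left a b)]

theorem mem_faces_iff_below (h : ¬ α.edgeGraph.Adj (a, b) (a + 1, b)) :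
    (a, b) ∈ α.interiorFaces ↔ (a, b - 1) ∈ α.interiorFaces := by
  have h := mt adj_right_of_mem_trace h
  rw [← mem_interior_iff_of_mem_closedCell h (mid_right_mem_above a b),
    ← mem_interior_iff_of_mem_closedCell h (mid_right_mem_below a b)]

theorem mem_faces_of_adj_up (h : α.subgraph.Adj (a, b) (a, b + 1))
    (h' : ¬ α.edgeGraph.Adj (a, b) (a, b + 1)) : (a, b) ∈ α.interiorFaces := by
  have h' := mt adj_up_of_mem_trace h'
  rw [← mem_interior_iff_of_mem_closedCell h' (mid_up_mem_right a b)]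
  refine (h.2 ?_).resolve_left h'
  rw [segment_up]
  exact ⟨rfl, by dsimp only; linarith, by dsimp only; linarith⟩

theorem mem_faces_of_adj_right (h : α.subgraph.Adj (a, b) (a + 1, b))
    (h' : ¬ α.edgeGraph.Adj (a, b) (a + 1, b)) : (a, b) ∈ α.interiorFaces := by
  have h' := mt adj_right_of_mem_trace h'
  rw [← mem_interior_iff_of_mem_closedCell h' (mid_right_mem_above a b)]
  refine (h.2 ?_).resolve_left h'
  rw [segment_right]
  exact ⟨rfl, by dsimp only; linarith, by dsimp only; linarith⟩

theorem adj_left_side (h : (a, b) ∈ α.interiorFaces) : α.subgraph.Adj (a, b) (a, b + 1) := by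
  refine ⟨adj_up a b, .trans ?_ (closedCell_subset h)⟩
  rw [segment_up]
  rintro ⟨s, t⟩ ⟨h1, h2⟩
  dsimp only at h1 h2
  exact ⟨⟨h1.ge, by dsimp only; linarith⟩, h2⟩

theorem adj_right_side (h : (a, b) ∈ α.interiorFaces) :
    α.subgraph.Adj (a + 1, b) (a + 1, b + 1) := by
  refine ⟨adj_up _ _, .trans ?_ (closedCell_subset h)⟩
  rw [segment_up]
  rintro ⟨s, t⟩ ⟨h1, h2⟩
  push_cast at h1
  dsimp only at h1 h2
  exact ⟨⟨by dsimp only; linarith, by dsimp only; linarith⟩, h2⟩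

theorem adj_bottom_side (h : (a, b) ∈ α.interiorFaces) : α.subgraph.Adj (a, b) (a + 1, b) := by
  refine ⟨adj_right a b, .trans ?_ (closedCell_subset h)⟩
  rw [segment_right]
  rintro ⟨s, t⟩ ⟨h1, h2⟩
  dsimp only at h1 h2
  exact ⟨h2, h1.ge, by dsimp only; linarith⟩

theorem adj_top_side (h : (a, b) ∈ α.interiorFaces) :
    α.subgraph.Adj (a, b + 1) (a + 1, b + 1) := by
  refine ⟨adj_right _ _, .trans ?_ (closedCell_subset h)⟩
  rw [segment_right]
  rintro ⟨s, t⟩ ⟨h1, h2⟩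
  push_cast at h1
  dsimp only at h1 h2
  exact ⟨h2, by dsimp only; linarith, by dsimp only; linarith⟩

end

/-- Near `s` the floor is `⌊s⌋` or `⌈s⌉ - 1`. Hence the closed cell picked by the floors of a nearby
point still contains the original point. -/
theorem eventually_mem_Icc_floor (s : ℝ) :
    ∀ᶠ u in nhds s, (⌊u⌋ : ℝ) ≤ s ∧ s ≤ (⌊u⌋ : ℝ) + 1 := by
  have h1 : ((⌈s⌉ - 1 : ℤ) : ℝ) < s := by
    push_cast; linarith [Int.ceil_lt_add_one s]
  filter_upwards [Ioo_mem_nhds h1 (Int.lt_floor_add_one s)] with u hu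
  constructor
  · have : ⌊u⌋ < ⌊s⌋ + 1 := Int.floor_lt.2 (by exact_mod_cast hu.2)
    exact (Int.cast_le.2 (Int.lt_add_one_iff.1 this)).trans (Int.floor_le s)
  · have : ⌈s⌉ - 1 ≤ ⌊u⌋ := Int.le_floor.2 hu.1.le
    have : (⌈s⌉ : ℝ) ≤ ((⌊u⌋ + 1 : ℤ) : ℝ) := by exact_mod_cast (by omega : ⌈s⌉ ≤ ⌊u⌋ + 1)
    push_cast at this
    exact (Int.le_ceil s).trans this

/-- A finite set of faces that can only be left across edges of the loop is in the interior. -/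
theorem subset_interiorFaces_of_finite {J : Set (ℤ × ℤ)} (hJ : J.Finite)
    (hv : ∀ a b, ¬ α.edgeGraph.Adj (a, b) (a, b + 1) → ((a, b) ∈ J ↔ (a - 1, b) ∈ J))
    (hh : ∀ a b, ¬ α.edgeGraph.Adj (a, b) (a + 1, b) → ((a, b) ∈ J ↔ (a, b - 1) ∈ J)) :
    J ⊆ α.interiorFaces := by
  have stepX : ∀ y ∉ α.trace, ∀ a a' b, y ∈ closedCell (a, b) → y ∈ closedCell (a', b) → a < a' →
      ((a, b) ∈ J ↔ (a', b) ∈ J) := by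
    intro y hy a a' b h h' hlt
    rw [mem_closedCell] at h h'
    have hle : (a' : ℝ) ≤ ((a + 1 : ℤ) : ℝ) := by push_cast; exact h'.1.1.trans h.1.2
    have hle : a' ≤ a + 1 := by exact_mod_cast hle
    obtain rfl : a' = a + 1 := by omega
    rw [hv (a + 1) b, add_sub_cancel_right]
    refine fun hadj => hy (segment_subset_trace hadj ?_)
    rw [segment_up]
    refine ⟨le_antisymm ?_ h'.1.1, h.2⟩
    push_cast; exact h.1.2
  have stepY : ∀ y ∉ α.trace, ∀ a b b', y ∈ closedCell (a, b) → y ∈ closedCell (a, b') → b < b' →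
      ((a, b) ∈ J ↔ (a, b') ∈ J) := by
    intro y hy a b b' h h' hlt
    rw [mem_closedCell] at h h'
    have hle : (b' : ℝ) ≤ ((b + 1 : ℤ) : ℝ) := by push_cast; exact h'.2.1.trans h.2.2
    have hle : b' ≤ b + 1 := by exact_mod_cast hle
    obtain rfl : b' = b + 1 := by omega
    rw [hh a (b + 1), add_sub_cancel_right]
    refine fun hadj => hy (segment_subset_trace hadj ?_)
    rw [segment_right]
    refine ⟨le_antisymm ?_ h'.2.1, h.1⟩
    push_cast; exact h.2.2
  -- Faces that meet only at a corner are compared through a third face in the row of one and the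
  -- column of the other.
  have step : ∀ y ∉ α.trace, ∀ g h, y ∈ closedCell g → y ∈ closedCell h → g ∈ J → h ∈ J := by
    rintro y hy ⟨a, b⟩ ⟨a', b'⟩ hg hh' hgJ
    have hmid : y ∈ closedCell (a', b) := ⟨hh'.1, hg.2⟩
    have h1 : (a', b) ∈ J := by
      rcases lt_trichotomy a a' with h | rfl | h
      · exact (stepX y hy _ _ _ hg hmid h).1 hgJ
      · exact hgJ
      · exact (stepX y hy _ _ _ hmid hg h).2 hgJ
    rcases lt_trichotomy b b' with h | rfl | h
    · exact (stepY y hy _ _ _ hmid hh' h).1 h1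
    · exact h1
    · exact (stepY y hy _ _ _ hh' hmid h).2 h1
  -- Off the loop `A` is both open and closed, so a component of the complement that meets `A` stays
  -- in this bounded set.
  set A : Set (ℝ × ℝ) := ⋃ f ∈ J, closedCell f with hA
  have hAclosed : IsClosed A := hJ.isClosed_biUnion fun f _ => isClosed_Icc.prod isClosed_Icc
  have hAbdd : Bornology.IsBounded A :=
    (Bornology.isBounded_biUnion hJ).2 fun f _ =>
      (Metric.isBounded_Icc _ _).prod (Metric.isBounded_Icc _ _)
  have hnhds : ∀ y ∈ A, y ∉ α.trace → A ∈ nhds y := by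
    intro y hy hyt
    obtain ⟨g, hg, hyg⟩ := Set.mem_iUnion₂.1 hy
    have := (eventually_mem_Icc_floor y.1).prodMk_nhds (eventually_mem_Icc_floor y.2)
    filter_upwards [this] with z hz
    refine Set.mem_iUnion₂.2 ⟨(⌊z.1⌋, ⌊z.2⌋), step y hyt g _ hyg hz hg, ?_⟩
    exact ⟨⟨Int.floor_le _, (Int.lt_floor_add_one _).le⟩,
      ⟨Int.floor_le _, (Int.lt_floor_add_one _).le⟩⟩
  intro f hf x hx
  have hxt := disjoint_cell_trace (α := α) f hx
  refine ⟨hxt, hAbdd.subset ?_⟩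
  have hxA : x ∈ A := Set.mem_iUnion₂.2 ⟨f, hf, closure_cell f ▸ subset_closure hx⟩
  refine .trans ?_ interior_subset
  refine isPreconnected_connectedComponentIn.subset_left_of_subset_union isOpen_interior
    hAclosed.isOpen_compl ?_ ?_ ⟨x, mem_connectedComponentIn hxt, ?_⟩
  · exact disjoint_compl_right.mono_left interior_subset
  · intro y hy
    by_cases hyA : y ∈ A
    · exact .inl (mem_interior_iff_mem_nhds.2
        (hnhds y hyA (connectedComponentIn_subset _ _ hy)))
    · exact .inr hyA
  · exact mem_interior_iff_mem_nhds.2 (hnhds x hxA hxt)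

end SimpleClosedLoop

end Plane
-- Crossing parity of walks with a ray from a face.
section Crossing

/-- `1` if the edge from `a` to `b` crosses the horizontal ray going right from the centre of the
face with bottom-left corner `f`, and `0` otherwise. -/
def rayCrossing (f a b : ℤ × ℤ) : ZMod 2 :=
  if a.1 = b.1 ∧ f.1 < a.1 ∧ min a.2 b.2 = f.2 then 1 else 0

variable {H : SimpleGraph (ℤ × ℤ)}

/-- The parity of the number of crossings of a walk with the ray going right from a face. -/
def crossing (f : ℤ × ℤ) : ∀ {a b : ℤ × ℤ}, H.Walk a b → ZMod 2
  | _, _, .nil => 0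
  | _, _, .cons (u := a) (v := b) _ p => rayCrossing f a b + crossing f p

theorem crossing_append (f : ℤ × ℤ) {a b c : ℤ × ℤ} (p : H.Walk a b) (q : H.Walk b c) :
    crossing f (p.append q) = crossing f p + crossing f q := by
  induction p with
  | nil => simp [crossing]
  | cons h p ih => simp [crossing, ih, add_assoc]

theorem crossing_mapLe_eq_zero {K : SimpleGraph (ℤ × ℤ)} (hK : K ≤ H) {f : ℤ × ℤ}
    (h0 : ∀ a b, K.Adj a b → rayCrossing f a b = 0) {a b : ℤ × ℤ} (p : K.Walk a b) :
    crossing f (p.mapLe hK) = 0 := by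
  induction p with
  | nil => rfl
  | cons h p ih => exact (congrArg₂ (· + ·) (h0 _ _ h) ih).trans (add_zero 0)

theorem crossing_eq_zero {f : ℤ × ℤ} (h0 : ∀ a b, H.Adj a b → rayCrossing f a b = 0)
    {a b : ℤ × ℤ} (p : H.Walk a b) : crossing f p = 0 := by
  induction p with
  | nil => rfl
  | cons h p ih => rw [crossing, h0 _ _ h, ih, add_zero]

theorem crossing_congr {f g : ℤ × ℤ}
    (h0 : ∀ a b, H.Adj a b → rayCrossing f a b = rayCrossing g a b)
    {a b : ℤ × ℤ} (p : H.Walk a b) : crossing f p = crossing g p := by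
  induction p with
  | nil => rfl
  | cons h p ih => rw [crossing, crossing, h0 _ _ h, ih]

/-- The sum telescopes modulo 2; in particular it vanishes on closed walks. -/
theorem crossing_eq_of_potential {f : ℤ × ℤ} (φ : ℤ × ℤ → ZMod 2)
    (h0 : ∀ a b, H.Adj a b → rayCrossing f a b = φ a + φ b)
    {a b : ℤ × ℤ} (p : H.Walk a b) : crossing f p = φ a + φ b := by
  induction p with
  | nil => exact (CharTwo.add_self_eq_zero _).symm
  | @cons a b c h p ih =>
    rw [crossing, h0 _ _ h, ih]
    linear_combination CharTwo.add_self_eq_zero (φ b)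

theorem crossing_add_eq_of_potential {f g : ℤ × ℤ} (φ : ℤ × ℤ → ZMod 2)
    (h0 : ∀ a b, H.Adj a b → rayCrossing f a b + rayCrossing g a b = φ a + φ b)
    {a b : ℤ × ℤ} (p : H.Walk a b) : crossing f p + crossing g p = φ a + φ b := by
  induction p with
  | nil => exact (add_zero 0).trans (CharTwo.add_self_eq_zero _).symm
  | @cons a b c h p ih =>
    rw [crossing, crossing]
    linear_combination CharTwo.add_self_eq_zero (φ b) + ih + h0 _ _ h

/-- The two rays differ only in crossing the edge between the two faces, which `H` lacks. -/
theorem crossing_eq_right (hH : H ≤ squareLattice) {x y : ℤ} (h : ¬ H.Adj (x, y) (x, y + 1))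
    {a b : ℤ × ℤ} (p : H.Walk a b) : crossing (x, y) p = crossing (x - 1, y) p := by
  refine crossing_congr (fun a b hab => if_congr ?_ rfl rfl) p
  obtain ⟨a, a'⟩ := a
  obtain ⟨b, b'⟩ := b
  dsimp only
  rcases adj_iff.1 (hH hab) with h' | h' | h' | h' <;> obtain ⟨rfl, rfl⟩ := Prod.mk.inj h' <;>
    dsimp only at *
  · have : ¬ (b = x ∧ a' = y) := by rintro ⟨rfl, rfl⟩; exact h hab
    omega
  · have : ¬ (a = x ∧ b' = y) := by rintro ⟨rfl, rfl⟩; exact h hab.symm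
    omega
  · omega
  · omega

/-- The two rays enclose the half-row of points at height `y` to the right of `x`. Without the edge
between the faces, a walk enters or leaves that half-row only by crossing one of the rays, and a
closed walk does so an even number of times. -/
theorem crossing_eq_above (hH : H ≤ squareLattice) {x y : ℤ} (h : ¬ H.Adj (x, y) (x + 1, y))
    {a : ℤ × ℤ} (p : H.Walk a a) : crossing (x, y) p = crossing (x, y - 1) p := by
  rw [← CharTwo.add_eq_zero, ← CharTwo.add_self_eq_zero (if a.2 = y ∧ x < a.1 then (1 : ZMod 2)
    else 0)]
  refine crossing_add_eq_of_potential (fun a => if a.2 = y ∧ x < a.1 then 1 else 0)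
    (fun a b hab => ?_) p
  obtain ⟨a, a'⟩ := a
  obtain ⟨b, b'⟩ := b
  simp only [rayCrossing]
  rcases adj_iff.1 (hH hab) with h' | h' | h' | h' <;> obtain ⟨rfl, rfl⟩ := Prod.mk.inj h' <;>
    dsimp only at *
  · split_ifs <;> first | (exfalso; omega) | rfl
  · split_ifs <;> first | (exfalso; omega) | rfl
  · have : ¬ (a = x ∧ b' = y) := by rintro ⟨rfl, rfl⟩; exact h hab
    split_ifs <;> first | (exfalso; omega) | rfl
  · have : ¬ (b = x ∧ a' = y) := by rintro ⟨rfl, rfl⟩; exact h hab.symm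
    split_ifs <;> first | (exfalso; omega) | rfl

/-- In a bounded graph, a closed walk winds around finitely many faces only. -/
theorem finite_crossing (hH : H ≤ squareLattice) {N : ℤ}
    (hN : ∀ a b, H.Adj a b → |a.1| ≤ N ∧ |a.2| ≤ N) {a : ℤ × ℤ} (p : H.Walk a a) : {f | crossing f p = 1}.Finite := by
  refine (Set.finite_Icc (-(N + 1), -(N + 1)) (N, N)).subset fun f hf => ?_
  by_contra hout
  refine zero_ne_one (α := ZMod 2) (Eq.trans ?_ hf)
  -- To the left of the graph, the ray meets every edge of `H` that crosses its height, and a closed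
  -- walk changes sides evenly often. The other far faces have rays that meet no edge of `H`.
  by_cases hleft : f.1 < -N
  · rw [← CharTwo.add_self_eq_zero (if f.2 < a.2 then (1 : ZMod 2) else 0)]
    refine (crossing_eq_of_potential (fun a => if f.2 < a.2 then 1 else 0)
      (fun a b hab => ?_) p).symm
    have h1 := (hN _ _ hab).1
    have h2 := (hN _ _ hab.symm).1
    rw [abs_le] at h1 h2
    obtain ⟨a, a'⟩ := a
    obtain ⟨b, b'⟩ := b
    simp only [rayCrossing]
    rcases adj_iff.1 (hH hab) with h' | h' | h' | h' <;> obtain ⟨rfl, rfl⟩ := Prod.mk.inj h' <;>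
      dsimp only at * <;> split_ifs <;> first | (exfalso; omega) | rfl
  · refine (crossing_eq_zero (fun a b hab => if_neg ?_) p).symm
    have h1 := hN _ _ hab
    have h2 := hN _ _ hab.symm
    simp only [abs_le] at h1 h2
    simp only [Set.mem_Icc, Prod.le_def] at hout
    omega

end Crossing

/-! ### The page order. -/

section Order

/-- The words-on-a-page order, as a lexicographic order. -/
def pageKey (p : ℤ × ℤ) : ℤ ×ₗ ℤ := toLex (-p.2, p.1)

theorem precedes_iff {p q : ℤ × ℤ} : Precedes p q ↔ pageKey p < pageKey q := by
  simp only [Precedes, pageKey, Prod.Lex.toLex_lt_toLex]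
  omega

theorem pageKey_injective : Function.Injective pageKey := by
  intro p q h
  have := toLex.injective h
  rw [Prod.mk.injEq] at this
  exact Prod.ext this.2 (neg_injective this.1)

theorem eq_of_adj_of_precedes {x y : ℤ} {q : ℤ × ℤ} (h : squareLattice.Adj (x, y) q)
    (hq : Precedes q (x, y)) : q = (x - 1, y) ∨ q = (x, y + 1) := by
  obtain ⟨c, d⟩ := q
  simp only [adj_iff, Precedes, Prod.mk.injEq] at *
  omega

end Order

/-! ### Faces enclosed by closed walks in the subgraph. -/

namespace SimpleClosedLoop

variable {α : SimpleClosedLoop}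

theorem interiorFaces_subset_verts : α.interiorFaces ⊆ α.subgraph.verts :=
  fun _ hf => (adj_left_side hf).fst_mem

/-- Consider the non-interior faces of odd crossing. Across an edge off the loop, both faces are
interior or neither is; in the latter case the edge is not in the subgraph and the parity agrees.
This finite set can thus be left only across loop edges, so its members would be interior, and it is
empty. -/
theorem mem_interiorFaces_of_crossing (hfin : α.subgraph.verts.Finite) {c : ℤ × ℤ}
    (p : α.subgraph.spanningCoe.Walk c c) {f : ℤ × ℤ} (hf : crossing f p = 1) :
    f ∈ α.interiorFaces := by
  have hle : α.subgraph.spanningCoe ≤ squareLattice := α.subgraph.spanningCoe_le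
  obtain ⟨N, hN⟩ : ∃ N : ℤ, ∀ a ∈ α.subgraph.verts, |a.1| ≤ N ∧ |a.2| ≤ N := by
    obtain ⟨N, hN⟩ := (hfin.image fun a => max |a.1| |a.2|).bddAbove
    exact ⟨N, fun a ha => max_le_iff.1 (hN ⟨a, ha, rfl⟩)⟩
  by_contra hfI
  have hJ : ({f | crossing f p = 1} \ α.interiorFaces).Finite :=
    (finite_crossing hle (fun a b hab => hN a hab.fst_mem) p).subset Set.sdiff_subset
  refine hfI (subset_interiorFaces_of_finite hJ ?_ ?_ ⟨hf, hfI⟩)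
  · intro a b hab
    have hI := mem_faces_iff_left hab
    by_cases h : (a, b) ∈ α.interiorFaces
    · exact iff_of_false (fun h' => h'.2 h) fun h' => h'.2 (hI.1 h)
    · have := crossing_eq_right hle (fun h' => h (mem_faces_of_adj_up h' hab)) p
      simp only [Set.mem_sdiff, Set.mem_ofPred_eq, this, hI]
  · intro a b hab
    have hI := mem_faces_iff_below hab
    by_cases h : (a, b) ∈ α.interiorFaces
    · exact iff_of_false (fun h' => h'.2 h) fun h' => h'.2 (hI.1 h)
    · have := crossing_eq_above hle (fun h' => h (mem_faces_of_adj_right h' hab)) p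
      simp only [Set.mem_sdiff, Set.mem_ofPred_eq, this, hI]

/-- If the two prior neighbours of a vertex are joined by a walk through prior vertices, then the
square having that vertex as bottom-right corner is interior to the loop. -/
theorem mem_interiorFaces_of_reachable (hfin : α.subgraph.verts.Finite) {x y : ℤ}
    (hu : α.subgraph.Adj (x - 1, y) (x, y)) (hw : α.subgraph.Adj (x, y + 1) (x, y))
    (h : (priorGraph α.subgraph (x, y)).spanningCoe.Reachable (x - 1, y) (x, y + 1)) :
    (x - 1, y) ∈ α.interiorFaces := by
  obtain ⟨q⟩ := h
  have hle : (priorGraph α.subgraph (x, y)).spanningCoe ≤ α.subgraph.spanningCoe :=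
    fun a b hab => hab.2.2
  let p : α.subgraph.spanningCoe.Walk (x, y) (x, y) :=
    .cons hu.symm ((q.mapLe hle).append (.cons hw .nil))
  refine mem_interiorFaces_of_crossing hfin p ?_
  -- An edge crossing this ray has its lower end at height `y` in column `x` or beyond, hence not
  -- prior to `(x, y)`. The only crossing is the final step down into `(x, y)`.
  have h0 : crossing (x - 1, y) (q.mapLe hle) = 0 := by
    refine crossing_mapLe_eq_zero hle (fun a b hab => if_neg ?_) q
    have ha : Precedes a (x, y) := hab.1.2
    have hb : Precedes b (x, y) := hab.2.1.2
    simp only [Precedes] at ha hb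
    omega
  have h1 : rayCrossing (x - 1, y) (x, y) (x - 1, y) = 0 := if_neg (by dsimp only; omega)
  have h2 : rayCrossing (x - 1, y) (x, y + 1) (x, y) = 1 := if_pos (by dsimp only; omega)
  simp only [p, crossing, crossing_append, h0, h1, h2, zero_add, add_zero]

theorem mem_interiorFaces_of_reachable_of_ne (hfin : α.subgraph.verts.Finite) {v q r : ℤ × ℤ}
    (hqr : q ≠ r) (hvq : α.subgraph.Adj v q) (hq : Precedes q v)
    (hvr : α.subgraph.Adj v r) (hr : Precedes r v)
    (h : (priorGraph α.subgraph v).spanningCoe.Reachable q r) :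
    (v.1 - 1, v.2) ∈ α.interiorFaces := by
  obtain ⟨x, y⟩ := v
  rcases eq_of_adj_of_precedes hvq.adj_sub hq with rfl | rfl <;>
    rcases eq_of_adj_of_precedes hvr.adj_sub hr with rfl | rfl
  · exact (hqr rfl).elim
  · exact mem_interiorFaces_of_reachable hfin hvq.symm hvr.symm h
  · exact mem_interiorFaces_of_reachable hfin hvr.symm hvq.symm h.symm
  · exact (hqr rfl).elim

/-- If the four edges are present, the left and top sides join the two prior neighbours of `v`
through prior vertices, so the face is interior. Conversely, the sides of an interior face lie in
its closure. -/
theorem box_le_iff (hfin : α.subgraph.verts.Finite) (v : ℤ × ℤ) :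
    box v ≤ α.subgraph ↔ (v.1 - 1, v.2) ∈ α.interiorFaces := by
  obtain ⟨x, y⟩ := v
  constructor
  · intro h
    have hadj : ∀ p q : ℤ × ℤ, p ∈ (box (x, y)).verts → q ∈ (box (x, y)).verts →
        squareLattice.Adj p q → α.subgraph.Adj p q := fun p q hp hq hpq => h.2 ⟨hp, hq, hpq⟩
    have m1 : (x, y) ∈ (box (x, y)).verts := by simp [box]
    have m2 : (x, y + 1) ∈ (box (x, y)).verts := by simp [box]
    have m3 : (x - 1, y + 1) ∈ (box (x, y)).verts := by simp [box]
    have m4 : (x - 1, y) ∈ (box (x, y)).verts := by simp [box]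
    have a1 := hadj _ _ m4 m1 (by simpa using adj_right (x - 1) y)
    have a2 := hadj _ _ m2 m1 (adj_up x y).symm
    have a3 := hadj _ _ m4 m3 (adj_up (x - 1) y)
    have a4 := hadj _ _ m3 m2 (by simpa using adj_right (x - 1) (y + 1))
    refine mem_interiorFaces_of_reachable hfin a1 a2 ?_
    have p2 : Precedes (x, y + 1) (x, y) := .inl (by dsimp only; omega)
    have p3 : Precedes (x - 1, y + 1) (x, y) := .inl (by dsimp only; omega)
    have p4 : Precedes (x - 1, y) (x, y) := .inr (by dsimp only; omega)
    have b1 : (priorGraph α.subgraph (x, y)).spanningCoe.Adj (x - 1, y) (x - 1, y + 1) :=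
      ⟨⟨a3.fst_mem, p4⟩, ⟨a3.snd_mem, p3⟩, a3⟩
    have b2 : (priorGraph α.subgraph (x, y)).spanningCoe.Adj (x - 1, y + 1) (x, y + 1) :=
      ⟨⟨a4.fst_mem, p3⟩, ⟨a4.snd_mem, p2⟩, a4⟩
    exact b1.reachable.trans b2.reachable
  · intro h
    have s1 := adj_left_side h
    have s2 := adj_right_side h
    have s3 := adj_bottom_side h
    have s4 := adj_top_side h
    simp only [sub_add_cancel] at s1 s2 s3 s4
    constructor
    · rintro p (rfl | rfl | rfl | rfl)
      · exact s3.snd_mem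
      · exact s4.snd_mem
      · exact s4.fst_mem
      · exact s3.fst_mem
    · rintro p q ⟨hp, hq, hpq⟩
      rw [SimpleGraph.Subgraph.top_adj, adj_iff] at hpq
      rcases hp with rfl | rfl | rfl | rfl <;> rcases hq with rfl | rfl | rfl | rfl <;>
        first
        | assumption
        | (apply SimpleGraph.Subgraph.Adj.symm; assumption)
        | (exfalso; simp only [Prod.mk.injEq] at hpq; omega)

end SimpleClosedLoop
-- Each loop edge separates an interior face from a non-interior one.
namespace SimpleClosedLoop

variable {α : SimpleClosedLoop}

theorem two_ne_zero_index : (2 : ZMod α.length) ≠ 0 := by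
  intro h
  have h := (ZMod.natCast_eq_zero_iff 2 α.length).1 (by exact_mod_cast h)
  exact absurd (Nat.le_of_dvd two_pos h) (by have := α.two_lt_length; omega)

theorem vertex_succ_ne_vertex_pred (i : ZMod α.length) :
    α.vertex (i + 1) ≠ α.vertex (i - 1) := by
  intro h
  refine two_ne_zero_index (α := α) ?_
  linear_combination α.injective h

/-- At the last loop vertex in page order, the rest of the loop joins its two loop neighbours
through prior vertices. -/
theorem interiorFaces_nonempty (hfin : α.subgraph.verts.Finite) : α.interiorFaces.Nonempty := by
  obtain ⟨i, hi⟩ := Finite.exists_max fun i => pageKey (α.vertex i)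
  have hprior : ∀ j ≠ i, Precedes (α.vertex j) (α.vertex i) := fun j hj =>
    precedes_iff.2 ((hi j).lt_of_ne fun h => hj (α.injective (pageKey_injective h)))
  have hne : ∀ k : ℕ, k + 1 < α.length → i + 1 + (k : ZMod α.length) ≠ i := by
    intro k hk h
    have h : ((k + 1 : ℕ) : ZMod α.length) = 0 := by push_cast; linear_combination h
    rw [ZMod.natCast_eq_zero_iff] at h
    exact absurd (Nat.le_of_dvd k.succ_pos h) (by omega)
  have hreach : ∀ k : ℕ, k + 1 < α.length →
      (priorGraph α.subgraph (α.vertex i)).spanningCoe.Reachable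
        (α.vertex (i + 1)) (α.vertex (i + 1 + k)) := by
    intro k
    induction k with
    | zero => intro _; rw [Nat.cast_zero, add_zero]
    | succ k ih =>
      intro hk
      refine (ih (by omega)).trans (SimpleGraph.Adj.reachable ?_)
      have h := subgraph_adj_of_edgeGraph_adj (edgeGraph_adj_vertex (i + 1 + (k : ZMod α.length)))
      have h1 := hprior _ (hne k (by omega))
      have h2 := hprior _ (hne (k + 1) hk)
      push_cast at h2 ⊢
      rw [← add_assoc] at h2 ⊢
      exact ⟨⟨h.fst_mem, h1⟩, ⟨h.snd_mem, h2⟩, h⟩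
  have hlast : i + 1 + ((α.length - 2 : ℕ) : ZMod α.length) = i - 1 := by
    rw [Nat.cast_sub α.two_lt_length.le, ZMod.natCast_self]
    push_cast; ring
  have h := hreach (α.length - 2) (by have := α.two_lt_length; omega)
  have hp := hprior _ (hne (α.length - 2) (by have := α.two_lt_length; omega))
  rw [hlast] at h hp
  have hadj := subgraph_adj_of_edgeGraph_adj (edgeGraph_adj_vertex (i - 1))
  rw [sub_add_cancel] at hadj
  refine ⟨_, mem_interiorFaces_of_reachable_of_ne hfin (vertex_succ_ne_vertex_pred i)
    (subgraph_adj_of_edgeGraph_adj (edgeGraph_adj_vertex i)) (hprior _ fun h => ?_)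
    hadj.symm hp h⟩
  exact (α.adj i).ne (by rw [h])

theorem eq_of_edgeGraph_adj_vertex {i : ZMod α.length} {q : ℤ × ℤ}
    (h : α.edgeGraph.Adj (α.vertex i) q) : q = α.vertex (i + 1) ∨ q = α.vertex (i - 1) := by
  obtain ⟨j, ⟨h1, rfl⟩ | ⟨rfl, h2⟩⟩ := h
  · left; rw [α.injective h1]
  · right; rw [← α.injective h2, add_sub_cancel_right]

variable (α) in
/-- The number, modulo `2`, of interior faces along the edge joining two adjacent points. -/
noncomputable def sideSum (p q : ℤ × ℤ) : ZMod 2 :=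
  if p.1 = q.1 then
    α.interiorFaces.indicator 1 (p.1, min p.2 q.2) +
      α.interiorFaces.indicator 1 (p.1 - 1, min p.2 q.2)
  else
    α.interiorFaces.indicator 1 (min p.1 q.1, p.2) +
      α.interiorFaces.indicator 1 (min p.1 q.1, p.2 - 1)

theorem sideSum_up (a b : ℤ) : α.sideSum (a, b) (a, b + 1) =
    α.interiorFaces.indicator 1 (a, b) + α.interiorFaces.indicator 1 (a - 1, b) := by
  simp [sideSum]

theorem sideSum_right (a b : ℤ) : α.sideSum (a, b) (a + 1, b) =
    α.interiorFaces.indicator 1 (a, b) + α.interiorFaces.indicator 1 (a, b - 1) := by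
  simp [sideSum]

theorem sideSum_comm {p q : ℤ × ℤ} (h : squareLattice.Adj p q) :
    α.sideSum p q = α.sideSum q p := by
  rcases h with ⟨h, -⟩ | ⟨h, -⟩
  · rw [sideSum, sideSum, if_pos h, if_pos h.symm, h, min_comm]
  · by_cases h' : p.1 = q.1
    · rw [Prod.ext h' h]
    · rw [sideSum, sideSum, if_neg h', if_neg (Ne.symm h'), h, min_comm]

theorem indicator_add_eq_zero {f g : ℤ × ℤ}
    (h : f ∈ α.interiorFaces ↔ g ∈ α.interiorFaces) :
    α.interiorFaces.indicator (1 : ℤ × ℤ → ZMod 2) f + α.interiorFaces.indicator 1 g = 0 := by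
  by_cases hf : f ∈ α.interiorFaces
  · rw [Set.indicator_of_mem hf, Set.indicator_of_mem (h.1 hf)]; rfl
  · rw [Set.indicator_of_notMem hf, Set.indicator_of_notMem (mt h.2 hf), add_zero]

theorem mem_iff_of_indicator_add_eq_zero {f g : ℤ × ℤ}
    (h : α.interiorFaces.indicator (1 : ℤ × ℤ → ZMod 2) f + α.interiorFaces.indicator 1 g = 0) :
    f ∈ α.interiorFaces ↔ g ∈ α.interiorFaces := by
  by_contra hne
  rcases not_iff.1 hne with h'
  by_cases hf : f ∈ α.interiorFaces
  · have hg : g ∉ α.interiorFaces := fun hg => h'.2 hg hf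
    rw [Set.indicator_of_mem hf, Set.indicator_of_notMem hg] at h
    simp at h
  · rw [Set.indicator_of_notMem hf, Set.indicator_of_mem (h'.1 hf)] at h
    simp at h

theorem sideSum_eq_zero {p q : ℤ × ℤ} (hpq : squareLattice.Adj p q)
    (h : ¬ α.edgeGraph.Adj p q) : α.sideSum p q = 0 := by
  obtain ⟨a, b⟩ := p
  obtain ⟨c, d⟩ := q
  rcases adj_iff.1 hpq with h' | h' | h' | h' <;> obtain ⟨rfl, rfl⟩ := Prod.mk.inj h'
  · rw [sideSum_up]
    exact indicator_add_eq_zero (mem_faces_iff_left h)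
  · rw [sideSum_comm hpq, sideSum_up]
    exact indicator_add_eq_zero (mem_faces_iff_left fun h' => h h'.symm)
  · rw [sideSum_right]
    exact indicator_add_eq_zero (mem_faces_iff_below h)
  · rw [sideSum_comm hpq, sideSum_right]
    exact indicator_add_eq_zero (mem_faces_iff_below fun h' => h h'.symm)

/-- The boundary of the set of interior faces is even at each lattice point. -/
theorem sum_sideSum (p : ℤ × ℤ) :
    ∑ q ∈ {(p.1, p.2 + 1), (p.1, p.2 - 1), (p.1 + 1, p.2), (p.1 - 1, p.2)}, α.sideSum p q = 0 := by
  obtain ⟨x, y⟩ := p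
  have h1 : α.sideSum (x, y) (x, y - 1) = α.sideSum (x, y - 1) (x, y - 1 + 1) := by
    rw [sideSum_comm (adj_up _ _), sub_add_cancel]
  have h2 : α.sideSum (x, y) (x - 1, y) = α.sideSum (x - 1, y) (x - 1 + 1, y) := by
    rw [sideSum_comm (adj_right _ _), sub_add_cancel]
  rw [Finset.sum_insert, Finset.sum_insert, Finset.sum_insert, Finset.sum_singleton, h1, h2]
  -- Each of the four faces around the point borders two of the four edges there.
  · rw [sideSum_up, sideSum_up, sideSum_right, sideSum_right]
    generalize α.interiorFaces.indicator (1 : ℤ × ℤ → ZMod 2) (x, y) = c1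
    generalize α.interiorFaces.indicator (1 : ℤ × ℤ → ZMod 2) (x - 1, y) = c2
    generalize α.interiorFaces.indicator (1 : ℤ × ℤ → ZMod 2) (x, y - 1) = c3
    generalize α.interiorFaces.indicator (1 : ℤ × ℤ → ZMod 2) (x - 1, y - 1) = c4
    decide +revert
  all_goals
    simp only [Finset.mem_insert, Finset.mem_singleton, Prod.mk.injEq]
    omega

theorem mem_neighbours_of_adj {p q : ℤ × ℤ} (h : squareLattice.Adj p q) :
    q ∈ ({(p.1, p.2 + 1), (p.1, p.2 - 1), (p.1 + 1, p.2), (p.1 - 1, p.2)} :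
      Finset (ℤ × ℤ)) := by
  obtain ⟨a, b⟩ := p
  obtain ⟨c, d⟩ := q
  rw [adj_iff] at h
  simp only [Finset.mem_insert, Finset.mem_singleton, Prod.mk.injEq] at *
  omega

theorem adj_of_mem_neighbours {p q : ℤ × ℤ}
    (h : q ∈ ({(p.1, p.2 + 1), (p.1, p.2 - 1), (p.1 + 1, p.2), (p.1 - 1, p.2)} :
      Finset (ℤ × ℤ))) : squareLattice.Adj p q := by
  obtain ⟨a, b⟩ := p
  obtain ⟨c, d⟩ := q
  rw [adj_iff]
  simp only [Finset.mem_insert, Finset.mem_singleton, Prod.mk.injEq] at *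
  omega

/-- Of the four edges at a loop vertex, only the two loop edges can contribute to the vanishing sum.
-/
theorem sideSum_succ_eq_sideSum_pred (i : ZMod α.length) :
    α.sideSum (α.vertex i) (α.vertex (i + 1)) = α.sideSum (α.vertex i) (α.vertex (i - 1)) := by
  have hadj : squareLattice.Adj (α.vertex i) (α.vertex (i - 1)) := by
    have := (α.adj (i - 1)).symm
    rwa [sub_add_cancel] at this
  have h := sum_sideSum (α := α) (α.vertex i)
  rw [← Finset.sum_subset (s₁ := {α.vertex (i + 1), α.vertex (i - 1)}),
    Finset.sum_pair (vertex_succ_ne_vertex_pred i)] at h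
  · exact CharTwo.add_eq_zero.1 h
  · intro q hq
    rw [Finset.mem_insert, Finset.mem_singleton] at hq
    rcases hq with rfl | rfl
    · exact mem_neighbours_of_adj (α.adj i)
    · exact mem_neighbours_of_adj hadj
  · intro q hq hq'
    refine sideSum_eq_zero (adj_of_mem_neighbours hq) fun hq2 => hq' ?_
    rw [Finset.mem_insert, Finset.mem_singleton]
    exact eq_of_edgeGraph_adj_vertex hq2

theorem sideSum_vertex (i : ZMod α.length) :
    α.sideSum (α.vertex i) (α.vertex (i + 1)) = α.sideSum (α.vertex 0) (α.vertex 1) := by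
  have h : ∀ n : ℕ, α.sideSum (α.vertex n) (α.vertex (n + 1)) =
      α.sideSum (α.vertex 0) (α.vertex 1) := by
    intro n
    induction n with
    | zero => simp
    | succ n ih =>
      rw [sideSum_succ_eq_sideSum_pred, Nat.cast_succ, add_sub_cancel_right,
        ← sideSum_comm (α.adj _), ih]
  have := h i.val
  rwa [ZMod.natCast_zmod_val] at this

/-- The value is constant along the loop. Were it 0, no edge would separate interior from
non-interior faces, and the whole row to the right of an interior face would be interior, against
finiteness. -/
theorem sideSum_eq_one (hfin : α.subgraph.verts.Finite) {p q : ℤ × ℤ}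
    (h : α.edgeGraph.Adj p q) : α.sideSum p q = 1 := by
  have hconst : ∀ {p q}, α.edgeGraph.Adj p q →
      α.sideSum p q = α.sideSum (α.vertex 0) (α.vertex 1) := by
    rintro p q ⟨i, ⟨rfl, rfl⟩ | ⟨rfl, rfl⟩⟩
    · exact sideSum_vertex i
    · rw [← sideSum_comm (α.adj i)]
      exact sideSum_vertex i
  rw [hconst h]
  refine (Fin.exists_fin_two.1 ⟨_, rfl⟩ : _ ∨ _).resolve_left fun h0 => ?_
  have h0 : ∀ {p q}, squareLattice.Adj p q → α.sideSum p q = 0 := by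
    intro p q hpq
    by_cases h : α.edgeGraph.Adj p q
    · rw [hconst h]; exact h0
    · exact sideSum_eq_zero hpq h
  obtain ⟨⟨a, b⟩, hab⟩ := interiorFaces_nonempty hfin
  have hall : ∀ n : ℕ, (a + n, b) ∈ α.interiorFaces := by
    intro n
    induction n with
    | zero => simpa using hab
    | succ n ih =>
      refine (mem_iff_of_indicator_add_eq_zero (α := α) ?_).2 ih
      have := h0 (adj_up (a + (n + 1 : ℕ)) b)
      rw [sideSum_up] at this
      rwa [show a + ((n + 1 : ℕ) : ℤ) - 1 = a + n by push_cast; ring] at this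
  refine Set.infinite_of_injective_forall_mem (f := fun n : ℕ => (a + (n : ℤ), b)) ?_ hall
    (hfin.subset interiorFaces_subset_verts)
  intro m n h
  simpa using h

theorem mem_faces_iff_left_notMem (hfin : α.subgraph.verts.Finite) {a b : ℤ}
    (h : α.edgeGraph.Adj (a, b) (a, b + 1)) :
    (a, b) ∈ α.interiorFaces ↔ (a - 1, b) ∉ α.interiorFaces := by
  by_contra hne
  have h1 := sideSum_eq_one hfin h
  rw [sideSum_up, indicator_add_eq_zero (by tauto)] at h1
  exact zero_ne_one h1

theorem mem_faces_iff_below_notMem (hfin : α.subgraph.verts.Finite) {a b : ℤ}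
    (h : α.edgeGraph.Adj (a, b) (a + 1, b)) :
    (a, b) ∈ α.interiorFaces ↔ (a, b - 1) ∉ α.interiorFaces := by
  by_contra hne
  have h1 := sideSum_eq_one hfin h
  rw [sideSum_right, indicator_add_eq_zero (by tauto)] at h1
  exact zero_ne_one h1

end SimpleClosedLoop
-- Counting edges by their adjacent faces.
open scoped symmDiff

theorem two_mul_ncard_union {β : Type*} {X Y : Set β} (hX : X.Finite) (hY : Y.Finite) :
    2 * (X ∪ Y).ncard = X.ncard + Y.ncard + (X ∆ Y).ncard := by
  have h1 := Set.ncard_union_add_ncard_inter X Y hX hY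
  have h2 := Set.ncard_sdiff_add_ncard_of_subset
    (Set.inter_subset_left.trans Set.subset_union_left : X ∩ Y ⊆ X ∪ Y) (hX.union hY)
  have h3 : X ∆ Y = (X ∪ Y) \ (X ∩ Y) := symmDiff_eq_sup_sdiff_inf X Y
  rw [h3]
  omega

/-- The lower endpoints of the vertical edges of a graph on the lattice points. -/
def verticalEdges (H : SimpleGraph (ℤ × ℤ)) : Set (ℤ × ℤ) := {p | H.Adj p (p.1, p.2 + 1)}

/-- The left endpoints of the horizontal edges of a graph on the lattice points. -/
def horizontalEdges (H : SimpleGraph (ℤ × ℤ)) : Set (ℤ × ℤ) := {p | H.Adj p (p.1 + 1, p.2)}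

theorem ncard_edgeSet {H : SimpleGraph (ℤ × ℤ)} (hH : H ≤ squareLattice)
    (hv : (verticalEdges H).Finite) (hh : (horizontalEdges H).Finite) :
    H.edgeSet.ncard = (verticalEdges H).ncard + (horizontalEdges H).ncard := by
  have hset : H.edgeSet = (fun p : ℤ × ℤ => s(p, (p.1, p.2 + 1))) '' verticalEdges H ∪
      (fun p : ℤ × ℤ => s(p, (p.1 + 1, p.2))) '' horizontalEdges H := by
    ext e
    induction e with | _ p q => ?_
    rw [SimpleGraph.mem_edgeSet]
    constructor
    · intro h
      rcases adj_iff.1 (hH h) with rfl | rfl | rfl | rfl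
      · exact .inl ⟨p, h, rfl⟩
      · exact .inl ⟨q, h.symm, Sym2.eq_swap⟩
      · exact .inr ⟨p, h, rfl⟩
      · exact .inr ⟨q, h.symm, Sym2.eq_swap⟩
    · rintro (⟨r, hr, he⟩ | ⟨r, hr, he⟩) <;>
        exact (SimpleGraph.mem_edgeSet H).1 (he ▸ (SimpleGraph.mem_edgeSet H).2 hr)
  rw [hset, Set.ncard_union_eq ?_ (hv.image _) (hh.image _), Set.ncard_image_of_injective,
    Set.ncard_image_of_injective]
  · rintro ⟨a, b⟩ ⟨c, d⟩ h
    simp only [Sym2.eq_iff, Prod.mk.injEq] at h ⊢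
    omega
  · rintro ⟨a, b⟩ ⟨c, d⟩ h
    simp only [Sym2.eq_iff, Prod.mk.injEq] at h ⊢
    omega
  · rw [Set.disjoint_left]
    rintro _ ⟨⟨a, b⟩, -, rfl⟩ ⟨⟨c, d⟩, -, h⟩
    simp only [Sym2.eq_iff, Prod.mk.injEq] at h
    omega

namespace SimpleClosedLoop

variable {α : SimpleClosedLoop}

theorem ncard_vertices : α.vertices.ncard = α.length := by
  rw [vertices, ← Set.image_univ, Set.ncard_image_of_injective _ α.injective, Set.ncard_univ,
    Nat.card_zmod]

theorem ncard_edgeGraph_edgeSet : α.edgeGraph.edgeSet.ncard = α.length := by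
  have hset : α.edgeGraph.edgeSet =
      (fun i => s(α.vertex i, α.vertex (i + 1))) '' Set.univ := by
    ext e
    induction e with | _ p q => ?_
    simp only [SimpleGraph.mem_edgeSet, Set.image_univ, Set.mem_range, Sym2.eq_iff]
    rfl
  rw [hset, Set.ncard_image_of_injective, Set.ncard_univ, Nat.card_zmod]
  intro i j h
  rcases Sym2.eq_iff.1 h with ⟨h, -⟩ | ⟨h1, h2⟩
  · exact α.injective h
  · exfalso
    have h1 := α.injective h1
    have h2 := α.injective h2
    refine two_ne_zero_index (α := α) ?_
    linear_combination h2 - h1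

theorem finite_interiorFaces (hfin : α.subgraph.verts.Finite) : α.interiorFaces.Finite :=
  hfin.subset interiorFaces_subset_verts

theorem horizontalEdges_finite {H : SimpleGraph (ℤ × ℤ)} (hfin : α.subgraph.verts.Finite)
    (hH : H ≤ α.subgraph.spanningCoe) : (horizontalEdges H).Finite :=
  hfin.subset fun _ hp => (hH hp).fst_mem

theorem verticalEdges_finite {H : SimpleGraph (ℤ × ℤ)} (hfin : α.subgraph.verts.Finite)
    (hH : H ≤ α.subgraph.spanningCoe) : (verticalEdges H).Finite :=
  hfin.subset fun _ hp => (hH hp).fst_mem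

/-- The lower end of a vertical edge labels the face on its right; shifting a face by one labels its
right side. The edge is in the subgraph when at least one of its two faces is interior (a union),
and on the loop when exactly one is (a symmetric difference). -/
theorem two_mul_ncard_verticalEdges (hfin : α.subgraph.verts.Finite) :
    2 * (verticalEdges α.subgraph.spanningCoe).ncard =
      2 * α.interiorFaces.ncard + (verticalEdges α.edgeGraph).ncard := by
  have hinj : Function.Injective fun p : ℤ × ℤ => (p.1 + 1, p.2) := by
    rintro ⟨a, b⟩ ⟨c, d⟩ h; simpa using h
  set Y := (fun p : ℤ × ℤ => (p.1 + 1, p.2)) '' α.interiorFaces with hY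
  have hmem : ∀ a b, (a, b) ∈ Y ↔ (a - 1, b) ∈ α.interiorFaces := by
    intro a b
    constructor
    · rintro ⟨⟨c, d⟩, h, he⟩
      obtain ⟨rfl, rfl⟩ := Prod.mk.inj he
      simpa using h
    · exact fun h => ⟨_, h, by simp⟩
  have h1 : verticalEdges α.subgraph.spanningCoe = α.interiorFaces ∪ Y := by
    ext ⟨a, b⟩
    rw [Set.mem_union, hmem]
    constructor
    · intro h
      by_cases h' : α.edgeGraph.Adj (a, b) (a, b + 1)
      · have := mem_faces_iff_left_notMem hfin h'
        tauto
      · exact .inl (mem_faces_of_adj_up h h')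
    · rintro (h | h)
      · exact adj_left_side h
      · have := adj_right_side h
        rwa [sub_add_cancel] at this
  have h2 : verticalEdges α.edgeGraph = α.interiorFaces ∆ Y := by
    ext ⟨a, b⟩
    rw [Set.mem_symmDiff, hmem]
    constructor
    · intro h
      have := mem_faces_iff_left_notMem hfin h
      tauto
    · intro h
      by_contra h'
      have := mem_faces_iff_left h'
      tauto
  have hI := finite_interiorFaces hfin
  rw [h1, h2, two_mul_ncard_union hI (hI.image _), hY, Set.ncard_image_of_injective _ hinj]
  ring

theorem two_mul_ncard_horizontalEdges (hfin : α.subgraph.verts.Finite) :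
    2 * (horizontalEdges α.subgraph.spanningCoe).ncard =
      2 * α.interiorFaces.ncard + (horizontalEdges α.edgeGraph).ncard := by
  have hinj : Function.Injective fun p : ℤ × ℤ => (p.1, p.2 + 1) := by
    rintro ⟨a, b⟩ ⟨c, d⟩ h; simpa using h
  set Y := (fun p : ℤ × ℤ => (p.1, p.2 + 1)) '' α.interiorFaces with hY
  have hmem : ∀ a b, (a, b) ∈ Y ↔ (a, b - 1) ∈ α.interiorFaces := by
    intro a b
    constructor
    · rintro ⟨⟨c, d⟩, h, he⟩
      obtain ⟨rfl, rfl⟩ := Prod.mk.inj he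
      simpa using h
    · exact fun h => ⟨_, h, by simp⟩
  have h1 : horizontalEdges α.subgraph.spanningCoe = α.interiorFaces ∪ Y := by
    ext ⟨a, b⟩
    rw [Set.mem_union, hmem]
    constructor
    · intro h
      by_cases h' : α.edgeGraph.Adj (a, b) (a + 1, b)
      · have := mem_faces_iff_below_notMem hfin h'
        tauto
      · exact .inl (mem_faces_of_adj_right h h')
    · rintro (h | h)
      · exact adj_bottom_side h
      · have := adj_top_side h
        rwa [sub_add_cancel] at this
  have h2 : horizontalEdges α.edgeGraph = α.interiorFaces ∆ Y := by
    ext ⟨a, b⟩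
    rw [Set.mem_symmDiff, hmem]
    constructor
    · intro h
      have := mem_faces_iff_below_notMem hfin h
      tauto
    · intro h
      by_contra h'
      have := mem_faces_iff_below h'
      tauto
  have hI := finite_interiorFaces hfin
  rw [h1, h2, two_mul_ncard_union hI (hI.image _), hY, Set.ncard_image_of_injective _ hinj]
  ring

/-! ### The comb spanning tree and the Pick-type formula. -/

variable (α) in
/-- The graph obtained by deleting the bottom edge of each interior face. -/
def combGraph : SimpleGraph (ℤ × ℤ) where
  Adj p q := α.subgraph.Adj p q ∧ ¬ (p.2 = q.2 ∧ (min p.1 q.1, p.2) ∈ α.interiorFaces)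
  symm := ⟨fun p q h => ⟨h.1.symm, fun h' => h.2 ⟨h'.1.symm, by
    rw [h'.1.symm, min_comm]; exact h'.2⟩⟩⟩
  loopless := ⟨fun _ h => h.1.ne rfl⟩

theorem combGraph_le : α.combGraph ≤ α.subgraph.spanningCoe := fun _ _ h => h.1

theorem reachable_priorGraph_of_walk {H : SimpleGraph (ℤ × ℤ)} {G : squareLattice.Subgraph}
    (hH : H ≤ G.spanningCoe) {v a b : ℤ × ℤ} (p : H.Walk a b)
    (hp : ∀ x ∈ p.support, Precedes x v) : (priorGraph G v).spanningCoe.Reachable a b := by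
  induction p with
  | nil => exact .refl _
  | cons h p ih =>
    rw [SimpleGraph.Walk.support_cons] at hp
    refine (SimpleGraph.Adj.reachable ?_).trans (ih fun x hx => hp x (.tail _ hx))
    have hG := hH h
    exact ⟨⟨hG.fst_mem, hp _ (.head _)⟩, ⟨hG.snd_mem, hp _ (.tail _ p.start_mem_support)⟩, hG⟩

/-- At the last vertex of a cycle in page order, the rest of the cycle joins the left and upper
neighbours through prior vertices. The face between them is then interior, so its bottom edge, which
the cycle uses, was deleted. -/
theorem isAcyclic_combGraph (hfin : α.subgraph.verts.Finite) : α.combGraph.IsAcyclic := by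
  classical
  intro a c hc
  obtain ⟨v, hv, hmax⟩ := c.support.toFinset.exists_max_image pageKey
    ⟨a, List.mem_toFinset.2 c.start_mem_support⟩
  rw [List.mem_toFinset] at hv
  have hprior : ∀ x ∈ (c.rotate v hv).support, x ≠ v → Precedes x v := by
    intro x hx hne
    rw [SimpleGraph.Walk.mem_support_rotate_iff] at hx
    exact precedes_iff.2 ((hmax x (List.mem_toFinset.2 hx)).lt_of_ne
      fun h => hne (pageKey_injective h))
  have hc' := hc.rotate hv
  generalize c.rotate v hv = c' at hc' hprior
  cases c' with
  | nil => exact hc'.ne_nil rfl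
  | @cons _ q _ hvq p =>
    rw [SimpleGraph.Walk.cons_isCycle_iff] at hc'
    obtain ⟨hp, hedge⟩ := hc'
    -- Reversing the path exposes the other cycle neighbour `r` of `v` as its first step.
    have hp' := hp.reverse
    have hedge' : s(v, q) ∉ p.reverse.edges := by simpa using hedge
    have hsupp : ∀ x ∈ p.reverse.support, x ∈ p.support := by simp
    generalize p.reverse = p' at hp' hedge' hsupp
    cases p' with
    | nil => exact hvq.ne rfl
    | @cons _ r _ hvr p' =>
      rw [SimpleGraph.Walk.cons_isPath_iff] at hp'
      have hqr : q ≠ r := by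
        rintro rfl
        exact hedge' (by simp)
      have hpr : ∀ x ∈ p'.support, Precedes x v := fun x hx =>
        hprior x (.tail _ (hsupp x (by simp [hx]))) fun h => hp'.2 (h ▸ hx)
      have hq := hpr q p'.end_mem_support
      have hr := hpr r p'.start_mem_support
      have hI := mem_interiorFaces_of_reachable_of_ne hfin hqr hvq.1 hq hvr.1 hr
        (reachable_priorGraph_of_walk combGraph_le p' hpr).symm
      have hnot : ¬ α.combGraph.Adj v (v.1 - 1, v.2) := fun h => h.2 ⟨rfl, by simpa using hI⟩
      rcases eq_of_adj_of_precedes hvq.1.adj_sub hq with h | h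
      · exact hnot (h ▸ hvq)
      · rcases eq_of_adj_of_precedes hvr.1.adj_sub hr with h' | h'
        · exact hnot (h' ▸ hvr)
        · exact hqr (h.trans h'.symm)

/-- A deleted bottom edge is bypassed along the other three sides of its face. The top side may be
deleted too, so the argument climbs, ending by the height bound `N`. -/
theorem combGraph_reachable_of_adj (hfin : α.subgraph.verts.Finite) {p q : ℤ × ℤ}
    (h : α.subgraph.Adj p q) : α.combGraph.Reachable p q := by
  obtain ⟨N, hN⟩ := (hfin.image Prod.snd).bddAbove
  have hvert : ∀ {a b}, α.subgraph.Adj (a, b) (a, b + 1) →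
      α.combGraph.Reachable (a, b) (a, b + 1) :=
    fun h => SimpleGraph.Adj.reachable ⟨h, fun h' => by simp at h'⟩
  have hhor : ∀ n : ℕ, ∀ {a b : ℤ}, N - b ≤ n → α.subgraph.Adj (a, b) (a + 1, b) →
      α.combGraph.Reachable (a, b) (a + 1, b) := by
    intro n
    induction n with
    | zero =>
      intro a b hb h
      refine SimpleGraph.Adj.reachable ⟨h, fun h' => ?_⟩
      have h' : (a, b) ∈ α.interiorFaces := by simpa using h'.2
      have h' := hN ⟨_, (adj_left_side h').snd_mem, rfl⟩
      dsimp only at h'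
      omega
    | succ n ih =>
      intro a b hb h
      by_cases hI : (a, b) ∈ α.interiorFaces
      · exact ((hvert (adj_left_side hI)).trans (ih (by push_cast at hb; omega)
          (adj_top_side hI))).trans (hvert (adj_right_side hI)).symm
      · exact SimpleGraph.Adj.reachable ⟨h, fun h' => hI (by simpa using h'.2)⟩
  obtain ⟨a, b⟩ := p
  obtain ⟨c, d⟩ := q
  rcases adj_iff.1 h.adj_sub with h' | h' | h' | h' <;> obtain ⟨rfl, rfl⟩ := Prod.mk.inj h'
  · exact hvert h
  · exact (hvert h.symm).symm
  · exact hhor _ (Int.self_le_toNat _) h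
  · exact (hhor _ (Int.self_le_toNat _) h.symm).symm

theorem combGraph_le_spanningCoe : α.combGraph ≤ α.subgraph.coe.spanningCoe := by
  rw [SimpleGraph.Subgraph.spanningCoe_coe]
  exact combGraph_le

theorem isTree_induce_combGraph (hG : IsGridGraph α.subgraph) :
    (α.combGraph.induce α.subgraph.verts).IsTree := by
  have hconn := hG.2.coe
  have := hconn.nonempty
  refine ⟨SimpleGraph.Connected.mk fun a b => ?_, (isAcyclic_combGraph hG.1).induce _⟩
  have h : α.subgraph.coe.Reachable a b := hconn.preconnected a b
  obtain ⟨p⟩ : α.combGraph.Reachable a b :=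
    reachable_of_forall_adj (H := α.subgraph.spanningCoe)
      (fun _ _ h => combGraph_reachable_of_adj hG.1 h)
      (h.map (⟨Subtype.val, fun h => h⟩ : α.subgraph.coe →g α.subgraph.spanningCoe))
  exact ⟨p.induce _ (mem_of_mem_support_of_spanningCoe combGraph_le_spanningCoe p a.2)⟩

theorem ncard_verts_eq (hG : IsGridGraph α.subgraph) :
    α.subgraph.verts.ncard =
      (verticalEdges α.combGraph).ncard + (horizontalEdges α.combGraph).ncard + 1 := by
  have : Finite α.subgraph.verts := hG.1
  have h := (SimpleGraph.isTree_iff_connected_and_card.1 (isTree_induce_combGraph hG)).2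
  have hedges : α.combGraph.edgeSet =
      Sym2.map Subtype.val '' (α.combGraph.induce α.subgraph.verts).edgeSet := by
    have hs : (α.combGraph.induce α.subgraph.verts).spanningCoe = α.combGraph := by
      rw [SimpleGraph.spanningCoe_induce_eq_self]
      rintro p ⟨q, hpq⟩
      exact hpq.1.fst_mem
    conv_lhs => rw [← hs]
    exact SimpleGraph.edgeSet_map _ _
  rw [← ncard_edgeSet (combGraph_le.trans α.subgraph.spanningCoe_le)
    (verticalEdges_finite hG.1 combGraph_le) (horizontalEdges_finite hG.1 combGraph_le), hedges,
    Set.ncard_image_of_injective _ (Sym2.map.injective Subtype.val_injective)]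
  exact h.symm

/-- A form of Pick's theorem. -/
theorem two_mul_ncard_verts (hG : IsGridGraph α.subgraph) :
    2 * α.subgraph.verts.ncard = 2 * α.interiorFaces.ncard + α.vertices.ncard + 2 := by
  have hle : α.edgeGraph ≤ α.subgraph.spanningCoe := fun _ _ h => subgraph_adj_of_edgeGraph_adj h
  have h1 := ncard_verts_eq hG
  have h2 := two_mul_ncard_verticalEdges hG.1
  have h3 := two_mul_ncard_horizontalEdges hG.1
  have h4 := ncard_edgeSet α.edgeGraph_le (verticalEdges_finite hG.1 hle)
    (horizontalEdges_finite hG.1 hle)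
  have h5 : verticalEdges α.combGraph = verticalEdges α.subgraph.spanningCoe := by
    ext ⟨a, b⟩
    exact ⟨fun h => h.1, fun h => ⟨h, fun h' => by simp at h'⟩⟩
  have h6 : horizontalEdges α.combGraph =
      horizontalEdges α.subgraph.spanningCoe \ α.interiorFaces := by
    ext ⟨a, b⟩
    exact ⟨fun h => ⟨h.1, fun h' => h.2 ⟨rfl, by simpa using h'⟩⟩,
      fun h => ⟨h.1, fun h' => h.2 (by simpa using h'.2)⟩⟩
  have h7 := Set.ncard_sdiff_add_ncard_of_subset
    (show α.interiorFaces ⊆ horizontalEdges α.subgraph.spanningCoe from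
      fun _ hf => adj_bottom_side hf) (horizontalEdges_finite hG.1 le_rfl)
  -- With `F` interior faces and loop length `L`, the tree gives V = E - F + 1, while counting sides
  -- gives 2E = 4F + L.
  rw [h5, h6] at h1
  rw [ncard_edgeGraph_edgeSet] at h4
  rw [ncard_vertices]
  omega

/-- Sending an interior face to its bottom-right corner is a bijection onto the vertices off the
top-left boundary. -/
theorem ncard_verts_eq_add_topLeftBoundary (hfin : α.subgraph.verts.Finite) :
    α.subgraph.verts.ncard =
      α.interiorFaces.ncard + (topLeftBoundary α.subgraph).ncard := by
  have hsub : topLeftBoundary α.subgraph ⊆ α.subgraph.verts := fun _ h => h.1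
  have hdiff : α.subgraph.verts \ topLeftBoundary α.subgraph =
      (fun p : ℤ × ℤ => (p.1 + 1, p.2)) '' α.interiorFaces := by
    ext ⟨a, b⟩
    constructor
    · rintro ⟨h1, h2⟩
      refine ⟨(a - 1, b), (box_le_iff hfin (a, b)).1 ?_, by simp⟩
      by_contra h
      exact h2 ⟨h1, h⟩
    · rintro ⟨⟨c, d⟩, h, he⟩
      obtain ⟨rfl, rfl⟩ := Prod.mk.inj he
      refine ⟨(adj_bottom_side h).snd_mem, fun h' => h'.2 ((box_le_iff hfin _).2 ?_)⟩
      simpa using h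
  have h := Set.ncard_sdiff_add_ncard_of_subset hsub hfin
  rw [hdiff, Set.ncard_image_of_injective] at h
  · exact h.symm
  · rintro ⟨a, b⟩ ⟨c, d⟩ h; simpa using h

end SimpleClosedLoop
-- The multiplier of a vertex and the final bound.
section

variable {G : squareLattice.Subgraph} {x y : ℤ}

theorem finite_edgeSet_induce (hfin : G.verts.Finite) {S : Set (ℤ × ℤ)} (hS : S ⊆ G.verts) :
    (G.induce S).spanningCoe.edgeSet.Finite := by
  refine ((hfin.prod hfin).image fun p => s(p.1, p.2)).subset fun e he => ?_
  induction e with | _ p q => ?_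
  exact ⟨(p, q), ⟨hS he.1, hS he.2.1⟩, rfl⟩

theorem uptoGraph_adj_iff {a b : ℤ × ℤ} : (uptoGraph G (x, y)).Adj a b ↔
    (priorGraph G (x, y)).Adj a b ∨
    (G.Adj (x, y) (x - 1, y) ∧ (a = (x, y) ∧ b = (x - 1, y) ∨ a = (x - 1, y) ∧ b = (x, y))) ∨
    (G.Adj (x, y) (x, y + 1) ∧ (a = (x, y) ∧ b = (x, y + 1) ∨ a = (x, y + 1) ∧ b = (x, y))) := by
  have hu : Precedes (x - 1, y) (x, y) := .inr (by dsimp only; omega)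
  have hw : Precedes (x, y + 1) (x, y) := .inl (by dsimp only; omega)
  constructor
  · rintro ⟨⟨ha, ha' | rfl⟩, ⟨hb, hb' | rfl⟩, hab⟩
    · exact .inl ⟨⟨ha, ha'⟩, ⟨hb, hb'⟩, hab⟩
    · rcases eq_of_adj_of_precedes hab.symm.adj_sub ha' with rfl | rfl
      · exact .inr (.inl ⟨hab.symm, .inr ⟨rfl, rfl⟩⟩)
      · exact .inr (.inr ⟨hab.symm, .inr ⟨rfl, rfl⟩⟩)
    · rcases eq_of_adj_of_precedes hab.adj_sub hb' with rfl | rfl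
      · exact .inr (.inl ⟨hab, .inl ⟨rfl, rfl⟩⟩)
      · exact .inr (.inr ⟨hab, .inl ⟨rfl, rfl⟩⟩)
    · exact (hab.ne rfl).elim
  · rintro (h | ⟨h, ⟨rfl, rfl⟩ | ⟨rfl, rfl⟩⟩ | ⟨h, ⟨rfl, rfl⟩ | ⟨rfl, rfl⟩⟩)
    · exact ⟨⟨h.1.1, .inl h.1.2⟩, ⟨h.2.1.1, .inl h.2.1.2⟩, h.2.2⟩
    · exact ⟨⟨h.fst_mem, .inr rfl⟩, ⟨h.snd_mem, .inl hu⟩, h⟩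
    · exact ⟨⟨h.snd_mem, .inl hu⟩, ⟨h.fst_mem, .inr rfl⟩, h.symm⟩
    · exact ⟨⟨h.fst_mem, .inr rfl⟩, ⟨h.snd_mem, .inl hw⟩, h⟩
    · exact ⟨⟨h.snd_mem, .inl hw⟩, ⟨h.fst_mem, .inr rfl⟩, h.symm⟩

/-- Since `v` is not prior to itself, it is isolated in the prior graph. -/
theorem not_reachable_priorGraph {v q : ℤ × ℤ} (hq : v ≠ q) :
    ¬ (priorGraph G v).spanningCoe.Reachable v q := by
  rintro ⟨p⟩
  cases p with
  | nil => exact hq rfl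
  | cons h p =>
    have : Precedes v v := h.1.2
    exact lt_irrefl _ (precedes_iff.1 this)

theorem edge_adj_iff_of_ne {V : Type*} {s t a b : V} (h : s ≠ t) :
    (SimpleGraph.edge s t).Adj a b ↔ a = s ∧ b = t ∨ a = t ∧ b = s := by
  rw [SimpleGraph.edge_adj]
  refine ⟨fun h => h.1, fun h' => ⟨h', ?_⟩⟩
  rcases h' with ⟨rfl, rfl⟩ | ⟨rfl, rfl⟩
  · exact h
  · exact h.symm

theorem ne_left (x y : ℤ) : (x, y) ≠ (x - 1, y) := fun h => by
  have := (Prod.mk.inj h).1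
  omega

theorem ne_above (x y : ℤ) : (x, y) ≠ (x, y + 1) := by simp

theorem uptoGraph_eq_sup_sup (hu : G.Adj (x, y) (x - 1, y)) (hw : G.Adj (x, y) (x, y + 1)) :
    (uptoGraph G (x, y)).spanningCoe = (priorGraph G (x, y)).spanningCoe ⊔
      SimpleGraph.edge (x, y) (x - 1, y) ⊔ SimpleGraph.edge (x, y) (x, y + 1) := by
  ext a b
  rw [SimpleGraph.Subgraph.spanningCoe_adj, uptoGraph_adj_iff, SimpleGraph.sup_adj,
    SimpleGraph.sup_adj, edge_adj_iff_of_ne (ne_left x y), edge_adj_iff_of_ne (ne_above x y),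
    SimpleGraph.Subgraph.spanningCoe_adj]
  tauto

end

namespace SimpleClosedLoop

variable {α : SimpleClosedLoop}

/-- The edge to the left is pendant. The edge upward then closes a walk of length 3 around the other
sides of the face, whence the factor 3 + 1. -/
theorem forestCount_uptoGraph_le (hfin : α.subgraph.verts.Finite) {v : ℤ × ℤ}
    (hv : (v.1 - 1, v.2) ∈ α.interiorFaces) :
    forestCount (uptoGraph α.subgraph v).spanningCoe ≤
      4 * forestCount (priorGraph α.subgraph v).spanningCoe := by
  obtain ⟨x, y⟩ := v
  have s1 := adj_left_side hv
  have s2 := adj_right_side hv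
  have s3 := adj_bottom_side hv
  have s4 := adj_top_side hv
  simp only [sub_add_cancel] at s1 s2 s3 s4
  have p2 : Precedes (x, y + 1) (x, y) := .inl (by dsimp only; omega)
  have p3 : Precedes (x - 1, y + 1) (x, y) := .inl (by dsimp only; omega)
  have p4 : Precedes (x - 1, y) (x, y) := .inr (by dsimp only; omega)
  have hle : (priorGraph α.subgraph (x, y)).spanningCoe ≤ (priorGraph α.subgraph (x, y)).spanningCoe
    ⊔ SimpleGraph.edge (x, y) (x - 1, y) := le_sup_left
  have b0 : ((priorGraph α.subgraph (x, y)).spanningCoe ⊔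
      SimpleGraph.edge (x, y) (x - 1, y)).Adj (x, y) (x - 1, y) :=
    .inr ((edge_adj_iff_of_ne (ne_left x y)).2 (.inl ⟨rfl, rfl⟩))
  have b1 : (priorGraph α.subgraph (x, y)).spanningCoe.Adj (x - 1, y) (x - 1, y + 1) :=
    ⟨⟨s1.fst_mem, p4⟩, ⟨s1.snd_mem, p3⟩, s1⟩
  have b2 : (priorGraph α.subgraph (x, y)).spanningCoe.Adj (x - 1, y + 1) (x, y + 1) :=
    ⟨⟨s4.fst_mem, p3⟩, ⟨s4.snd_mem, p2⟩, s4⟩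
  rw [uptoGraph_eq_sup_sup s3.symm s2]
  refine (forestCount_sup_edge_le ?_ (.cons b0 (.cons (hle b1) (.cons (hle b2) .nil)))).trans_eq ?_
  · rw [SimpleGraph.edgeSet_sup]
    refine (finite_edgeSet_induce hfin fun _ h => h.1).union ?_
    exact (Set.finite_singleton s((x, y), (x - 1, y))).subset (SimpleGraph.edgeSet_edge_subset)
  · rw [forestCount_sup_edge_of_not_reachable (not_reachable_priorGraph (ne_left x y))]
    rfl

/-- Every edge added with `v` joins distinct components: two neighbours already joined through prior
vertices would make the face interior. -/
theorem forestCount_uptoGraph_eq (hfin : α.subgraph.verts.Finite) {v : ℤ × ℤ}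
    (hv : (v.1 - 1, v.2) ∉ α.interiorFaces) :
    forestCount (uptoGraph α.subgraph v).spanningCoe =
      forestCount (priorGraph α.subgraph v).spanningCoe := by
  obtain ⟨x, y⟩ := v
  have hnu := not_reachable_priorGraph (G := α.subgraph) (ne_left x y)
  have hnw := not_reachable_priorGraph (G := α.subgraph) (ne_above x y)
  have pu : Precedes (x - 1, y) (x, y) := .inr (by dsimp only; omega)
  have pw : Precedes (x, y + 1) (x, y) := .inl (by dsimp only; omega)
  by_cases hu : α.subgraph.Adj (x, y) (x - 1, y) <;>
    by_cases hw : α.subgraph.Adj (x, y) (x, y + 1)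
  · rw [uptoGraph_eq_sup_sup hu hw, forestCount_sup_edge_of_not_reachable,
      forestCount_sup_edge_of_not_reachable hnu]
    intro h
    rcases reachable_of_sup_edge h with h | ⟨-, h | h⟩
    · exact hnw h
    · exact hnw h
    · exact hv (mem_interiorFaces_of_reachable_of_ne hfin (by simp) hu pu hw pw h)
  · rw [← forestCount_sup_edge_of_not_reachable hnu]
    congr 1
    ext a b
    rw [SimpleGraph.Subgraph.spanningCoe_adj, uptoGraph_adj_iff, SimpleGraph.sup_adj,
      edge_adj_iff_of_ne (ne_left x y), SimpleGraph.Subgraph.spanningCoe_adj]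
    tauto
  · rw [← forestCount_sup_edge_of_not_reachable hnw]
    congr 1
    ext a b
    rw [SimpleGraph.Subgraph.spanningCoe_adj, uptoGraph_adj_iff, SimpleGraph.sup_adj,
      edge_adj_iff_of_ne (ne_above x y), SimpleGraph.Subgraph.spanningCoe_adj]
    tauto
  · congr 1
    ext a b
    rw [SimpleGraph.Subgraph.spanningCoe_adj, uptoGraph_adj_iff,
      SimpleGraph.Subgraph.spanningCoe_adj]
    tauto

theorem mem_interiorFaces_iff_notMem_topLeftBoundary (hfin : α.subgraph.verts.Finite) {v : ℤ × ℤ}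
    (hv : v ∈ α.subgraph.verts) :
    (v.1 - 1, v.2) ∈ α.interiorFaces ↔ v ∉ topLeftBoundary α.subgraph := by
  rw [← box_le_iff hfin]
  exact ⟨fun h h' => h'.2 h, fun h => by_contra fun h' => h ⟨hv, h'⟩⟩

/-- An initial segment of the vertices in the words-on-a-page order has at most `4 ^ k` spanning
forests, where `k` is the number of its vertices off the top-left boundary. -/
theorem forestCount_induce_le (hfin : α.subgraph.verts.Finite) (n : ℕ) {S : Set (ℤ × ℤ)}
    (hn : S.ncard = n) (hS : S ⊆ α.subgraph.verts)
    (hlower : ∀ p ∈ S, ∀ q ∈ α.subgraph.verts, Precedes q p → q ∈ S) :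
    forestCount (α.subgraph.induce S).spanningCoe ≤
      4 ^ (S \ topLeftBoundary α.subgraph).ncard := by
  have hSfin := hfin.subset hS
  induction n generalizing S with
  | zero =>
    obtain rfl := (Set.ncard_eq_zero hSfin).1 hn
    rw [SimpleGraph.Subgraph.induce_empty, SimpleGraph.Subgraph.spanningCoe_bot, forestCount_bot]
    exact Nat.one_le_pow _ _ (by norm_num)
  | succ n ih =>
    -- For the last vertex `v` of the initial segment `S`, the graphs induced by `S` and `S \ {v}`
    -- are `H_v` and `H'_v`.
    obtain ⟨v, hv, hmax⟩ := Set.exists_max_image S pageKey hSfin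
      ((Set.ncard_pos hSfin).1 (by omega))
    have hlt : ∀ p ∈ S, p ≠ v → Precedes p v := fun p hp hne =>
      precedes_iff.2 ((hmax p hp).lt_of_ne fun h => hne (pageKey_injective h))
    have hirr : ∀ p, ¬ Precedes p p := fun p h => lt_irrefl _ (precedes_iff.1 h)
    have h1 : S \ {v} = {w ∈ α.subgraph.verts | Precedes w v} := by
      ext p
      refine ⟨fun h => ⟨hS h.1, hlt p h.1 h.2⟩, fun h => ⟨hlower v hv p h.1 h.2, ?_⟩⟩
      rintro rfl
      exact hirr _ h.2
    have h2 : S = {w ∈ α.subgraph.verts | Precedes w v ∨ w = v} := by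
      ext p
      constructor
      · intro h
        by_cases hp : p = v
        · exact ⟨hS h, .inr hp⟩
        · exact ⟨hS h, .inl (hlt p h hp)⟩
      · rintro ⟨hp, hp' | rfl⟩
        · exact hlower v hv p hp hp'
        · exact hv
    have hprior := ih (S := S \ {v}) (by rw [Set.ncard_sdiff_singleton_of_mem hv, hn]; rfl)
      (Set.sdiff_subset.trans hS) (fun p hp q hq hqp => ⟨hlower p hp.1 q hq hqp, by
        rintro rfl
        exact lt_asymm (precedes_iff.1 hqp) (precedes_iff.1 (hlt p hp.1 hp.2))⟩)
      (hSfin.subset Set.sdiff_subset)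
    have e1 : α.subgraph.induce (S \ {v}) = priorGraph α.subgraph v := by rw [h1]; rfl
    have e2 : α.subgraph.induce S = uptoGraph α.subgraph v := by rw [h2]; rfl
    rw [e1] at hprior
    rw [e2]
    have hcomm : (S \ {v}) \ topLeftBoundary α.subgraph =
        (S \ topLeftBoundary α.subgraph) \ {v} := by
      ext p; simp only [Set.mem_sdiff]; tauto
    by_cases hvI : (v.1 - 1, v.2) ∈ α.interiorFaces
    · have hvT := (mem_interiorFaces_iff_notMem_topLeftBoundary hfin (hS hv)).1 hvI
      have hcard := Set.ncard_sdiff_singleton_add_one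
        (show v ∈ S \ topLeftBoundary α.subgraph from ⟨hv, hvT⟩) (hSfin.subset Set.sdiff_subset)
      rw [← hcard, pow_succ', ← hcomm]
      exact (forestCount_uptoGraph_le hfin hvI).trans (Nat.mul_le_mul_left 4 hprior)
    · have hvT : v ∈ topLeftBoundary α.subgraph := by
        by_contra h
        exact hvI ((mem_interiorFaces_iff_notMem_topLeftBoundary hfin (hS hv)).2 h)
      rw [forestCount_uptoGraph_eq hfin hvI]
      rw [hcomm, Set.sdiff_singleton_eq_self fun h => h.2 hvT] at hprior
      exact hprior

theorem multiplier_le_four (hfin : α.subgraph.verts.Finite) {v : ℤ × ℤ}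
    (hv : v ∈ α.subgraph.verts) (hvT : v ∉ topLeftBoundary α.subgraph) :
    multiplier α.subgraph v ≤ 4 := by
  have h := forestCount_uptoGraph_le hfin
    ((mem_interiorFaces_iff_notMem_topLeftBoundary hfin hv).2 hvT)
  rw [multiplier, tau_coe, tau_coe]
  refine div_le_of_le_mul₀ (Nat.cast_nonneg _) (by norm_num) ?_
  exact_mod_cast h

theorem multiplier_eq_one (hfin : α.subgraph.verts.Finite) {v : ℤ × ℤ}
    (hvT : v ∈ topLeftBoundary α.subgraph) : multiplier α.subgraph v = 1 := by
  have h := forestCount_uptoGraph_eq hfin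
    fun h => (mem_interiorFaces_iff_notMem_topLeftBoundary hfin hvT.1).1 h hvT
  rw [multiplier, tau_coe, tau_coe, h]
  refine div_self (Nat.cast_ne_zero.2 (forestCount_pos ?_).ne')
  exact finite_edgeSet_induce hfin fun _ h => h.1

theorem tau_coe_le (hfin : α.subgraph.verts.Finite) : tau α.subgraph.coe ≤ 4 ^ α.area := by
  -- The whole vertex set is itself an initial segment.
  have h := forestCount_induce_le hfin _ rfl subset_rfl fun p _ q hq _ => hq
  have h1 := Set.ncard_sdiff_add_ncard_of_subset
    (show topLeftBoundary α.subgraph ⊆ α.subgraph.verts from fun _ h => h.1) hfin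
  have h2 := ncard_verts_eq_add_topLeftBoundary hfin
  rw [SimpleGraph.Subgraph.induce_self_verts,
    show (α.subgraph.verts \ topLeftBoundary α.subgraph).ncard = α.interiorFaces.ncard by omega]
    at h
  rw [tau_coe]
  exact h

end SimpleClosedLoop
end GridGraph

theorem proposition6p1 (G : GridGraph.squareLattice.Subgraph) (hG : GridGraph.IsGridGraph G)
    (α : GridGraph.SimpleClosedLoop) (hα : G = α.subgraph) :
    (∀ v ∈ G.verts, v ∉ GridGraph.topLeftBoundary G → GridGraph.multiplier G v ≤ 4) ∧
    (∀ v ∈ GridGraph.topLeftBoundary G, GridGraph.multiplier G v = 1) ∧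
    (∃ m : ℕ,
      GridGraph.tau G.coe ≤ 4 ^ m ∧
      m = α.area ∧
      (m : ℝ) = (G.verts.ncard : ℝ) - (α.vertices.ncard : ℝ) / 2 - 1 ∧
      (m : ℝ) = (G.verts.ncard : ℝ) - ((GridGraph.topLeftBoundary G).ncard : ℝ)) := by
  subst hα
  refine ⟨fun v => GridGraph.SimpleClosedLoop.multiplier_le_four hG.1,
    fun v => GridGraph.SimpleClosedLoop.multiplier_eq_one hG.1, α.area,
    GridGraph.SimpleClosedLoop.tau_coe_le hG.1, rfl, ?_, ?_⟩
  · have h : 2 * (α.subgraph.verts.ncard : ℝ) = 2 * α.area + α.vertices.ncard + 2 := by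
      exact_mod_cast GridGraph.SimpleClosedLoop.two_mul_ncard_verts hG
    linarith
  · have h : (α.subgraph.verts.ncard : ℝ) =
        α.area + (GridGraph.topLeftBoundary α.subgraph).ncard := by
      exact_mod_cast GridGraph.SimpleClosedLoop.ncard_verts_eq_add_topLeftBoundary hG.1
    linarith
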